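/- Let $\alpha\in(0,2)$ and let $X_1,X_2,\dots$ be i.i.d. copies of a real random variable $\xi$ that is symmetric ($\xi\stackrel{d}{=}-\xi$) and regularly varying with index $\alpha$, i.e. $\mathbb P(|\xi|>x)=x^{-\alpha}L(x)$ for all $x>0$, where $L:(0,\infty)\to(0,\infty)$ satisfies $L(tx)/L(x)\to1$ as $x\to\infty$ for every $t>0$. Let $$\mathbf y^{(n)}=\Big(\frac{X_1}{\sqrt{X_1^2+\cdots+X_n^2}},\dots,\frac{X_n}{\sqrt{X_1^2+\cdots+X_n^2}}\Big)^{\top}$$ (set to $0$ if $X_1=\dots=X_n=0$). Let $\mathbf A_n=(a^{(n)}_{ij})_{i,j=1}^n$, $n\ge1$, be random complex Hermitian $n\times n$ matrices, defined on the same probability space, such that $\mathbf A_n$ is independent of $\mathbf y^{(n)}$ for every $n$. Assume that 1. $\limsup_{n\to\infty}\max_{1\le i\le n}|a^{(n)}_{ii}|<\infty$ almost surely; 2. almost surely, $\frac1n\sum_{i=1}^n\delta_{a^{(n)}_{ii}}$ converges weakly to a deterministic probability measure $\nu$ on $\mathbb R$; 3. $n^{-2}\,\mathbb E\big[\|\mathbf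 A_n-\operatorname{diag}(\mathbf A_n)\|_F^2\big]\to0$ as $n\to\infty$, where $\|\cdot\|_F$ is the Frobenius norm. Then there is a unique probability measure $\mu_{\nu,\alpha}$ on $\mathbb R$ such that, for every $z\in\mathbb C$ outside the closed convex hull of $\operatorname{supp}(\nu)$, one has $z\notin\operatorname{supp}(\mu_{\nu,\alpha})$ and the Stieltjes transform of $\mu_{\nu,\alpha}$ is given by $$\int_{\mathbb R}\frac{\mu_{\nu,\alpha}(dx)}{x-z}=-\frac{\int_{\mathbb R}(z-x)^{\frac{\alpha}{2}-1}\,\nu(dx)}{\int_{\mathbb R}(z-x)^{\frac{\alpha}{2}}\,\nu(dx)}$$ (principal branches of the powers), and the quadratic form $Q_n=(\mathbf y^{(n)})^{\top}\mathbf A_n\mathbf y^{(n)}$ converges in distribution to $\mu_{\nu,\alpha}$ as $n\to\infty$. -/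

import Mathlib

open MeasureTheory ProbabilityTheory Filter Topology
open scoped ENNReal NNReal Matrix

noncomputable section

namespace HeavyQuadForm

/-- `L` is slowly varying at infinity: `L (t x) / L x → 1` as `x → ∞`, for every `t > 0`. -/
def SlowlyVarying (L : ℝ → ℝ) : Prop :=
  ∀ t : ℝ, 0 < t → Tendsto (fun x : ℝ => L (t * x) / L x) atTop (𝓝 1)

/-- The tail of `|ξ|` is regularly varying with index `α`: `P(|ξ| > x) = x^{-α} L(x)` for all
`x > 0`, with a positive slowly varying function `L` on `(0, ∞)`. -/
def RegularlyVaryingTail {Ω : Type*} [MeasurableSpace Ω] (P : Measure Ω) (ξ : Ω → ℝ) (α : ℝ) :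
    Prop :=
  ∃ L : ℝ → ℝ, (∀ x : ℝ, 0 < x → 0 < L x) ∧ SlowlyVarying L ∧
    ∀ x : ℝ, 0 < x → P.real {ω | x < |ξ ω|} = x ^ (-α) * L x

/-- The self-normalized vector `x / ‖x‖₂` built from the first `n` terms of a sequence
(it is the zero vector when these terms all vanish). -/
def selfNormalized (n : ℕ) (x : ℕ → ℝ) : Fin n → ℝ :=
  fun i => x i / √(∑ j : Fin n, x j ^ 2)

/-- The quadratic form `yᵀ A y` of a real vector `y` and a complex matrix `A`. Only its real part
is recorded; for Hermitian `A` nothing is lost, see `ofReal_quadForm`. -/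
def quadForm {n : ℕ} (y : Fin n → ℝ) (A : Matrix (Fin n) (Fin n) ℂ) : ℝ :=
  ((fun i => (y i : ℂ)) ⬝ᵥ (A *ᵥ (fun i => (y i : ℂ)))).re

theorem ofReal_quadForm {n : ℕ} (y : Fin n → ℝ) {A : Matrix (Fin n) (Fin n) ℂ}
    (hA : A.IsHermitian) :
    ((quadForm y A : ℝ) : ℂ) = (fun i => (y i : ℂ)) ⬝ᵥ (A *ᵥ (fun i => (y i : ℂ))) := by
  have hs : star (fun i => (y i : ℂ)) = fun i => (y i : ℂ) := by
    ext i; simp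
  have h := hA.im_star_dotProduct_mulVec_self (fun i => (y i : ℂ))
  rw [hs] at h
  apply Complex.ext
  · simp [quadForm]
  · simpa using h.symm

/-- The Frobenius norm of a complex square matrix. -/
def frobNorm {n : ℕ} (B : Matrix (Fin n) (Fin n) ℂ) : ℝ :=
  Matrix.frobeniusNormedAddCommGroup.toNorm.norm B

/-- The off-diagonal part `A - diag(A)`. -/
def offDiagPart {n : ℕ} (A : Matrix (Fin n) (Fin n) ℂ) : Matrix (Fin n) (Fin n) ℂ :=
  A - Matrix.diagonal A.diag

/-- The empirical measure `n⁻¹ ∑ᵢ δ_{aᵢᵢ}` of the diagonal of a Hermitian matrix, whose diagonal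
entries are real. It is a probability measure for `n ≥ 1` and the zero measure for `n = 0`. -/
def empiricalDiag {n : ℕ} (A : Matrix (Fin n) (Fin n) ℂ) : FiniteMeasure ℝ :=
  ((n : ℝ≥0)⁻¹) • ∑ i : Fin n, (diracProba (A i i).re).toFiniteMeasure

/-- `μ` is the law with parameters `ν` and `α`: off the closed convex hull of the support of `ν`
its Stieltjes transform `s(z) = ∫ (x - z)⁻¹ μ(dx)` is defined (that is, `z` is not in the support
of `μ`) and equals `-∫ (z - x)^{α/2 - 1} ν(dx) / ∫ (z - x)^{α/2} ν(dx)`, with principal powers.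
`resolventTransform μ z` is the Stieltjes transform for `μ` on `ℝ` and `z` in `ℂ`. -/
def IsQuadFormLaw (ν : ProbabilityMeasure ℝ) (α : ℝ) (μ : ProbabilityMeasure ℝ) : Prop :=
  ∀ z : ℂ, z ∉ Complex.ofReal '' closure (convexHull ℝ (ν : Measure ℝ).support) →
    z ∉ Complex.ofReal '' (μ : Measure ℝ).support ∧
    resolventTransform (μ : Measure ℝ) z =
      -((∫ x : ℝ, (z - (x : ℂ)) ^ (((α / 2 - 1 : ℝ)) : ℂ) ∂(ν : Measure ℝ)) /
        (∫ x : ℝ, (z - (x : ℂ)) ^ (((α / 2 : ℝ)) : ℂ) ∂(ν : Measure ℝ)))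

end HeavyQuadForm

end

open scoped BoundedContinuousFunction

noncomputable section

namespace HeavyQuadForm

/-! Split the form into its diagonal part `∑ aᵢᵢ yᵢ²` and an off-diagonal remainder. Symmetry kills
every mixed fourth moment of the normalized vector except those pairing each index with itself. By
exchangeability the survivors are of order `n⁻²`. So the remainder has second moment at most `4 n⁻²
E‖A - diag A‖_F²` (`integral_offDiag_sq_le`) and vanishes in probability, and Slutsky's theorem
leaves the diagonal part.

By independence the diagonal `d` may be frozen. The diagonal form is then the mean of the `dᵢ` with
random weights proportional to `Xᵢ²`. These squares have a regularly varying tail of index `a = α/2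
< 1`. An Abelian argument provides a scale `sₙ` with `n (1 - E exp(-sₙ u X²)) → u^a`
(`exists_scale`). Hence `E exp(-u sₙ ∑ cᵢ Xᵢ²) → exp(-u^a m)`, where `m` is the limiting average of
`cᵢ^a` (`tendsto_prod_sqLaplace`).

Frullani's formula `log (B / S) = ∫ (e^{-uS} - e^{-uB}) / u du` turns these Laplace transforms into
the expected logarithm of a ratio: `E log (∑ cᵢ Xᵢ² / ∑ Xᵢ²) → a⁻¹ log m`
(`tendsto_integral_log_ratio`). With `cᵢ = σ (z - dᵢ)` the ratio is `σ` times the distance from `z`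
to the weighted mean. Every limit law `ρ` therefore has the logarithmic potential `∫ log (σ (z - x))
ρ(dx) = a⁻¹ log ∫ (σ (z - x))^a ν(dx)` for real `z` on either side of the interval. Its derivative
in `z` is the claimed Stieltjes transform. Values near `+∞` already determine a compactly supported
law (`eq_of_real_stieltjes_eq`), so compactness yields convergence (`HasScale.exists_tendsto`). The
identity theorem carries the formula to complex `z` (`resolventTransform_eq_of_real`). -/

/-! ### Regular variation: Potter bound and Abelian theorem. -/

/-- A Potter-type bound for a monotone function whose ratio `G (2 x) / G x` has a limit
larger than `2 ^ (-β)`. -/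
theorem exists_potter_bound {G : ℝ → ℝ} {a β : ℝ} (hβ : 0 ≤ β) (hab : a < β)
    (hpos : ∀ x, 0 < x → 0 < G x) (hle : ∀ x, G x ≤ 1) (hanti : Antitone G)
    (hrat : Tendsto (fun x => G (2 * x) / G x) atTop (𝓝 (2 ^ (-a)))) :
    ∃ x₀ C : ℝ, 0 < x₀ ∧ 0 ≤ C ∧ ∀ x, x₀ ≤ x → ∀ v, 0 < v → v ≤ 1 →
      G (v * x) ≤ C * v ^ (-β) * G x := by
  have h2 : (2 : ℝ) ^ (-β) < 2 ^ (-a) :=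
    Real.rpow_lt_rpow_of_exponent_lt one_lt_two (by linarith)
  obtain ⟨x₁, hx₁⟩ := eventually_atTop.1 (hrat.eventually (eventually_gt_nhds h2))
  set x₀ := max x₁ 1 with hx₀
  have hx₀pos : 0 < x₀ := lt_of_lt_of_le one_pos (le_max_right _ _)
  have hG₀ : 0 < G x₀ := hpos _ hx₀pos
  have h2β : (0 : ℝ) < 2 ^ β := Real.rpow_pos_of_pos two_pos _
  have step : ∀ y, x₀ ≤ y → G y ≤ 2 ^ β * G (2 * y) := by
    intro y hy
    have h := hx₁ y ((le_max_left _ _).trans hy)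
    have hGy := hpos y (hx₀pos.trans_le hy)
    rw [lt_div_iff₀ hGy, Real.rpow_neg two_pos.le] at h
    have := mul_lt_mul_of_pos_left h h2β
    rw [← mul_assoc, mul_inv_cancel₀ h2β.ne', one_mul] at this
    exact this.le
  have iter : ∀ k : ℕ, ∀ y, x₀ ≤ y → G y ≤ (2 ^ β) ^ k * G (2 ^ k * y) := by
    intro k
    induction k with
    | zero => intro y _; simp
    | succ k ih =>
      intro y hy
      have h1 : (1 : ℝ) ≤ 2 ^ k := one_le_pow₀ one_le_two
      have hky : x₀ ≤ 2 ^ k * y := hy.trans (le_mul_of_one_le_left (hx₀pos.le.trans hy) h1)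
      calc G y ≤ (2 ^ β) ^ k * G (2 ^ k * y) := ih y hy
        _ ≤ (2 ^ β) ^ k * (2 ^ β * G (2 * (2 ^ k * y))) := by
          gcongr; exact step _ hky
        _ = _ := by rw [pow_succ, pow_succ]; ring_nf
  -- With `2 ^ k ≤ x / y < 2 ^ (k + 1)`, iterate the doubling inequality `k + 1` times. The
  -- overshoot beyond `x` is absorbed by monotonicity and costs one factor `2 ^ β`.
  have potter : ∀ y x, x₀ ≤ y → y ≤ x → G y ≤ 2 ^ β * (x / y) ^ β * G x := by
    intro y x hy hyx
    have hy0 : 0 < y := hx₀pos.trans_le hy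
    obtain ⟨k, hk1, hk2⟩ := exists_nat_pow_near (one_le_div hy0 |>.2 hyx) one_lt_two
    have hGx : 0 < G x := hpos x (hy0.trans_le hyx)
    calc G y ≤ (2 ^ β) ^ (k + 1) * G (2 ^ (k + 1) * y) := iter (k + 1) y hy
      _ ≤ (2 ^ β) ^ (k + 1) * G x := by
        gcongr
        exact hanti ((div_lt_iff₀ hy0).1 hk2).le
      _ = 2 ^ β * (2 ^ k) ^ β * G x := by
        rw [pow_succ, ← Real.rpow_natCast (2 ^ β) k, ← Real.rpow_mul two_pos.le,
          mul_comm β, Real.rpow_mul two_pos.le, Real.rpow_natCast]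
        ring
      _ ≤ _ := by gcongr
  -- Dividing by `G x₀ ≤ 1` makes one constant serve two regimes. For `v x < x₀`, where doubling is
  -- not controlled, `G (v x) ≤ 1` is compared with `G x₀`.
  refine ⟨x₀, 2 ^ β / G x₀, hx₀pos, by positivity, fun x hx v hv hv1 => ?_⟩
  have hx0 : 0 < x := hx₀pos.trans_le hx
  have hGx : 0 < G x := hpos x hx0
  rcases le_or_gt x₀ (v * x) with h | h
  · have := potter (v * x) x h (mul_le_of_le_one_left hx0.le hv1)
    refine this.trans ?_
    have e : x / (v * x) = v⁻¹ := by field_simp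
    rw [e, Real.inv_rpow hv.le, ← Real.rpow_neg hv.le]
    gcongr
    exact le_div_self h2β.le hG₀ (hle _)
  · have h1 := potter x₀ x le_rfl hx
    have h3 : (x / x₀) ^ β ≤ v ^ (-β) := by
      rw [Real.rpow_neg hv.le, ← Real.inv_rpow hv.le]
      refine Real.rpow_le_rpow (by positivity) ?_ hβ
      rw [div_le_iff₀ hx₀pos, inv_mul_eq_div, le_div_iff₀ hv, mul_comm]
      exact h.le
    calc G (v * x) ≤ 1 := hle _
      _ = G x₀ / G x₀ := (div_self hG₀.ne').symm
      _ ≤ 2 ^ β * v ^ (-β) * G x / G x₀ := by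
        gcongr
        refine h1.trans ?_
        gcongr
      _ = _ := by ring

/-- Abelian step: Laplace-type averages of a regularly varying monotone function. -/
theorem tendsto_laplace_average {G : ℝ → ℝ} {a : ℝ} (ha₀ : 0 < a) (ha₁ : a < 1)
    (hpos : ∀ x, 0 < x → 0 < G x) (hle : ∀ x, G x ≤ 1) (hanti : Antitone G)
    (hrat : ∀ t, 0 < t → Tendsto (fun x => G (t * x) / G x) atTop (𝓝 (t ^ (-a)))) :
    Tendsto (fun x => (∫ v in Set.Ioi 0, Real.exp (-v) * G (v * x)) / G x) atTop
      (𝓝 (Real.Gamma (1 - a))) := by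
  -- The Potter bound needs `a < β`; integrability of `v ^ (-β)` at the origin needs `β < 1`.
  obtain ⟨β, hβ₁, hβ₂⟩ := exists_between ha₁
  obtain ⟨x₀, C, hx₀, hC, hpot⟩ := exists_potter_bound (ha₀.trans hβ₁).le hβ₁ hpos hle hanti
    (hrat 2 two_pos)
  have key : Tendsto (fun x => ∫ v in Set.Ioi 0, Real.exp (-v) * (G (v * x) / G x)) atTop
      (𝓝 (∫ v in Set.Ioi 0, Real.exp (-v) * v ^ ((1 - a) - 1))) := by
    refine tendsto_integral_filter_of_dominated_convergence
      (fun v => C * (Real.exp (-v) * v ^ ((1 - β) - 1)) + Real.exp (-v)) ?_ ?_ ?_ ?_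
    · filter_upwards [eventually_gt_atTop 0] with x hx
      have : Antitone fun v => G (v * x) := fun v w h => hanti (by gcongr)
      exact ((by fun_prop : Measurable fun v : ℝ => Real.exp (-v)).mul
        (this.measurable.div_const _)).aestronglyMeasurable
    · filter_upwards [eventually_ge_atTop x₀] with x hx
      have hx0 : 0 < x := hx₀.trans_le hx
      have hGx := hpos x hx0
      refine (ae_restrict_iff' measurableSet_Ioi).2 (Eventually.of_forall fun v (hv : 0 < v) => ?_)
      have hr : 0 ≤ G (v * x) / G x := div_nonneg (hpos _ (by positivity)).le hGx.le
      rw [Real.norm_of_nonneg (by positivity)]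
      have hvp : 0 ≤ v ^ ((1 - β) - 1) := Real.rpow_nonneg hv.le _
      rcases le_or_gt v 1 with h | h
      · have : G (v * x) / G x ≤ C * v ^ ((1 - β) - 1) := by
          rw [div_le_iff₀ hGx, show (1 - β) - 1 = -β by ring]
          exact hpot x hx v hv h
        calc Real.exp (-v) * (G (v * x) / G x) ≤ Real.exp (-v) * (C * v ^ ((1 - β) - 1)) := by
              gcongr
          _ ≤ _ := by nlinarith [Real.exp_pos (-v)]
      · have : G (v * x) / G x ≤ 1 := by
          rw [div_le_one hGx]; exact hanti (le_mul_of_one_le_left hx0.le h.le)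
        calc Real.exp (-v) * (G (v * x) / G x) ≤ Real.exp (-v) * 1 := by gcongr
          _ ≤ _ := by rw [mul_one]; exact le_add_of_nonneg_left (by positivity)
    · refine Integrable.add ?_ (integrableOn_exp_neg_Ioi 0)
      exact (Real.GammaIntegral_convergent (by linarith)).const_mul C
    · refine (ae_restrict_iff' measurableSet_Ioi).2 (Eventually.of_forall fun v (hv : 0 < v) => ?_)
      rw [show (1 - a) - 1 = -a by ring]
      exact (hrat v hv).const_mul _
  rw [Real.Gamma_eq_integral (by linarith)]
  refine key.congr fun x => ?_
  simp_rw [← mul_div_assoc]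
  exact integral_div _ _

/-! ### Laplace transform of the square of a heavy-tailed variable. -/

/-- The Laplace transform of the image of `μ` under squaring. -/
def sqLaplace (μ : Measure ℝ) (s : ℝ) : ℝ := ∫ x, Real.exp (-(s * x ^ 2)) ∂μ

/-- The tail of the square of a variable with regularly varying tail. -/
theorem sq_tail_regular {μ : Measure ℝ} {α : ℝ} {L : ℝ → ℝ} (hLpos : ∀ x, 0 < x → 0 < L x) (hL : SlowlyVarying L)
    (htail : ∀ x, 0 < x → μ.real {y | x < |y|} = x ^ (-α) * L x) :
    (∀ x, 0 < x → 0 < μ.real {y : ℝ | x < y ^ 2}) ∧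
    ∀ t, 0 < t → Tendsto (fun x => μ.real {y : ℝ | t * x < y ^ 2} / μ.real {y : ℝ | x < y ^ 2})
      atTop (𝓝 (t ^ (-(α / 2)))) := by
  have hG : ∀ x, 0 < x → μ.real {y : ℝ | x < y ^ 2} = (√x) ^ (-α) * L (√x) := by
    intro x hx
    rw [← htail _ (Real.sqrt_pos.2 hx)]
    congr 1
    ext y
    simp only [Set.mem_ofPred_eq]
    rw [← sq_abs y, Real.sqrt_lt hx.le (abs_nonneg y)]
  refine ⟨fun x hx => ?_, fun t ht => ?_⟩
  · rw [hG x hx]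
    exact mul_pos (Real.rpow_pos_of_pos (Real.sqrt_pos.2 hx) _) (hLpos _ (Real.sqrt_pos.2 hx))
  · have h1 := ((hL (√t) (Real.sqrt_pos.2 ht)).comp Real.tendsto_sqrt_atTop).const_mul
      (t ^ (-(α / 2)))
    rw [mul_one] at h1
    refine h1.congr' ?_
    filter_upwards [eventually_gt_atTop 0] with x hx
    have hsx := Real.sqrt_pos.2 hx
    have := Real.rpow_pos_of_pos hsx (-α)
    have := hLpos _ hsx
    rw [hG x hx, hG _ (mul_pos ht hx), Real.sqrt_mul ht.le,
      Real.mul_rpow (Real.sqrt_nonneg _) (Real.sqrt_nonneg _), Real.sqrt_eq_rpow t,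
      ← Real.rpow_mul ht.le, show 1 / 2 * -α = -(α / 2) by ring]
    simp only [Function.comp]
    field_simp

section sqLaplace

variable {μ : Measure ℝ} [IsProbabilityMeasure μ]

theorem exp_neg_mul_sq_le_one {s x : ℝ} (hs : 0 ≤ s) : Real.exp (-(s * x ^ 2)) ≤ 1 :=
  Real.exp_le_one_iff.2 (neg_nonpos.2 (by positivity))

theorem integrable_exp_neg_mul_sq {s : ℝ} (hs : 0 ≤ s) :
    Integrable (fun x : ℝ => Real.exp (-(s * x ^ 2))) μ := by
  refine Integrable.of_bound (C := 1) (by fun_prop) (Eventually.of_forall fun x => ?_)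
  rw [Real.norm_of_nonneg (Real.exp_nonneg _)]
  exact exp_neg_mul_sq_le_one hs

theorem sqLaplace_zero : sqLaplace μ 0 = 1 := by simp [sqLaplace]

theorem sqLaplace_le_one {s : ℝ} (hs : 0 ≤ s) : sqLaplace μ s ≤ 1 := by
  have := integral_mono (integrable_exp_neg_mul_sq (μ := μ) hs) (integrable_const 1)
    (fun x => exp_neg_mul_sq_le_one hs)
  simpa [sqLaplace] using this

theorem sqLaplace_antitoneOn : AntitoneOn (sqLaplace μ) (Set.Ici 0) := by
  intro s hs t ht hst
  refine integral_mono (integrable_exp_neg_mul_sq ht) (integrable_exp_neg_mul_sq hs) fun x => ?_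
  simp only
  gcongr

theorem continuousOn_sqLaplace : ContinuousOn (sqLaplace μ) (Set.Ici 0) := by
  refine continuousOn_of_dominated (bound := fun _ => 1) (fun s _ => by fun_prop) ?_
    (integrable_const 1) (Eventually.of_forall fun x => by fun_prop)
  intro s hs
  refine Eventually.of_forall fun x => ?_
  rw [Real.norm_of_nonneg (Real.exp_nonneg _)]
  exact exp_neg_mul_sq_le_one hs

/-- Layer-cake formula for `s x²` with density `e^{-v}`, since `∫₀^y e^{-v} dv = 1 - e^{-y}`. It
puts `1 - sqLaplace` in the form treated by `tendsto_laplace_average`, at the point `s⁻¹`. -/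
theorem one_sub_sqLaplace_eq {s : ℝ} (hs : 0 < s) :
    1 - sqLaplace μ s =
      ∫ v in Set.Ioi 0, Real.exp (-v) * μ.real {x | v * s⁻¹ < x ^ 2} := by
  have h := lintegral_comp_eq_lintegral_meas_lt_mul (f := fun x : ℝ => s * x ^ 2)
    (g := fun v => Real.exp (-v)) μ (Eventually.of_forall fun x => by positivity)
    (by fun_prop) (fun t _ => (by fun_prop : Continuous fun v : ℝ => Real.exp (-v)).intervalIntegrable _ _)
    (Eventually.of_forall fun v => (Real.exp_pos _).le)
  have e1 : ∀ y : ℝ, ∫ t in (0 : ℝ)..y, Real.exp (-t) = 1 - Real.exp (-y) := by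
    intro y
    rw [intervalIntegral.integral_comp_neg (fun t => Real.exp t), integral_exp]; simp
  simp_rw [e1] at h
  have hset : ∀ v : ℝ, {x : ℝ | v < s * x ^ 2} = {x : ℝ | v * s⁻¹ < x ^ 2} := by
    intro v; ext x
    simp only [Set.mem_ofPred_eq]
    rw [← div_eq_mul_inv, div_lt_iff₀ hs, mul_comm s]
  simp_rw [hset] at h
  have hl : 1 - sqLaplace μ s = ∫ x, (1 - Real.exp (-(s * x ^ 2))) ∂μ := by
    rw [integral_sub (integrable_const 1) (integrable_exp_neg_mul_sq hs.le)]; simp [sqLaplace]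
  rw [hl, integral_eq_lintegral_of_nonneg_ae, integral_eq_lintegral_of_nonneg_ae, h]
  · congr 1
    refine lintegral_congr fun v => ?_
    rw [ENNReal.ofReal_mul (Real.exp_pos _).le, ofReal_measureReal, mul_comm]
  · exact Eventually.of_forall fun v => by positivity
  · have : Antitone fun v : ℝ => μ.real {x : ℝ | v * s⁻¹ < x ^ 2} := fun v w hvw => by
      refine measureReal_mono ?_
      intro x hx
      rw [Set.mem_ofPred_eq] at hx ⊢
      exact lt_of_le_of_lt (by gcongr) hx
    exact ((by fun_prop : Measurable fun v : ℝ => Real.exp (-v)).mul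
      this.measurable).aestronglyMeasurable
  · exact Eventually.of_forall fun x => sub_nonneg.2 (exp_neg_mul_sq_le_one hs.le)
  · fun_prop

/-- The Laplace transform of the square of a variable with regularly varying tail is regularly
varying at the origin; in normalized form, along a scale `s n`. -/
theorem exists_scale {a : ℝ} (ha₀ : 0 < a) (ha₁ : a < 1)
    (hpos : ∀ x, 0 < x → 0 < μ.real {y : ℝ | x < y ^ 2})
    (hrat : ∀ t, 0 < t →
      Tendsto (fun x => μ.real {y : ℝ | t * x < y ^ 2} / μ.real {y : ℝ | x < y ^ 2})
      atTop (𝓝 (t ^ (-a)))) :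
    ∃ s : ℕ → ℝ, (∀ᶠ n in atTop, 0 < s n) ∧
      ∀ u, 0 < u → Tendsto (fun n : ℕ => n * (1 - sqLaplace μ (s n * u))) atTop (𝓝 (u ^ a)) := by
  set G : ℝ → ℝ := fun x => μ.real {y : ℝ | x < y ^ 2} with hG
  set ψ : ℝ → ℝ := fun s => 1 - sqLaplace μ s with hψ
  have hanti : Antitone G := fun x y hxy => measureReal_mono fun z hz => lt_of_le_of_lt hxy hz
  have hκ : 0 < Real.Gamma (1 - a) := Real.Gamma_pos_of_pos (by linarith)
  have hlim := tendsto_laplace_average ha₀ ha₁ hpos (fun x => measureReal_le_one) hanti hrat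
  have hlim1 : Tendsto (fun x => ψ x⁻¹ / G x) atTop (𝓝 (Real.Gamma (1 - a))) := by
    refine hlim.congr' ?_
    filter_upwards [eventually_gt_atTop 0] with x hx
    rw [hψ]
    simp only
    rw [one_sub_sqLaplace_eq (inv_pos.2 hx), inv_inv]
  -- The factor `Γ(1 - a)` relating `ψ s` to the tail at `s⁻¹` cancels in the quotient, so `ψ`
  -- inherits index `a` at the origin.
  have hψrat : ∀ u, 0 < u → Tendsto (fun s => ψ (s * u) / ψ s) (𝓝[>] 0) (𝓝 (u ^ a)) := by
    intro u hu
    have h1 : Tendsto (fun x => ψ (u⁻¹ * x)⁻¹ / G (u⁻¹ * x)) atTop (𝓝 (Real.Gamma (1 - a))) :=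
      hlim1.comp (tendsto_id.const_mul_atTop (inv_pos.2 hu))
    have h2 := (h1.mul (hrat u⁻¹ (inv_pos.2 hu))).div hlim1 hκ.ne'
    have e : Real.Gamma (1 - a) * u⁻¹ ^ (-a) / Real.Gamma (1 - a) = u ^ a := by
      rw [Real.rpow_neg (inv_nonneg.2 hu.le), Real.inv_rpow hu.le, inv_inv]
      field_simp
    rw [e] at h2
    refine (h2.comp tendsto_inv_nhdsGT_zero).congr' ?_
    filter_upwards [self_mem_nhdsWithin] with s (hs : 0 < s)
    have hg1 := hpos (u⁻¹ * s⁻¹) (by positivity)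
    have hg2 := hpos s⁻¹ (by positivity)
    simp only [Pi.div_apply, Function.comp, inv_inv, mul_inv]
    rw [mul_comm u s]
    change ψ (s * u) / G (u⁻¹ * s⁻¹) * (G (u⁻¹ * s⁻¹) / G s⁻¹) / (ψ s / G s⁻¹) = _
    have hg1' : G (u⁻¹ * s⁻¹) ≠ 0 := hg1.ne'
    have hg2' : G s⁻¹ ≠ 0 := hg2.ne'
    rw [div_mul_div_cancel₀ hg1', div_div_div_cancel_right₀ hg2']
  have hψpos : ∀ s, 0 < s → 0 < ψ s := by
    intro s hs
    have h0 : ∫ x, (1 - Real.exp (-(s * x ^ 2))) ∂μ = ψ s := by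
      rw [integral_sub (integrable_const 1) (integrable_exp_neg_mul_sq hs.le)]; simp [hψ, sqLaplace]
    rw [← h0, integral_pos_iff_support_of_nonneg]
    · have h1 := hpos 1 one_pos
      rw [measureReal_def, ENNReal.toReal_pos_iff] at h1
      refine h1.1.trans_le (measure_mono fun x (hx : 1 < x ^ 2) => ?_)
      rw [Function.mem_support]
      have : Real.exp (-(s * x ^ 2)) < 1 := Real.exp_lt_one_iff.2 (by nlinarith)
      linarith
    · exact fun x => sub_nonneg.2 (exp_neg_mul_sq_le_one hs.le)
    · exact (integrable_const 1).sub (integrable_exp_neg_mul_sq hs.le)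
  have hψmono : MonotoneOn ψ (Set.Ici 0) := fun x hx y hy h =>
    sub_le_sub_left (sqLaplace_antitoneOn hx hy h) 1
  have hψcont : ContinuousOn ψ (Set.Icc 0 1) :=
    (continuousOn_const.sub continuousOn_sqLaplace).mono Set.Icc_subset_Ici_self
  have hψ0 : ψ 0 = 0 := by simp [hψ, sqLaplace_zero]
  have hinv : Tendsto (fun n : ℕ => (n : ℝ)⁻¹) atTop (𝓝 0) := tendsto_inv_atTop_nhds_zero_nat
  have hex : ∀ n : ℕ, ∃ s, (n : ℝ)⁻¹ ≤ ψ 1 → 0 ≤ s ∧ ψ s = (n : ℝ)⁻¹ := by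
    intro n
    by_cases hn : (n : ℝ)⁻¹ ≤ ψ 1
    · obtain ⟨s, hs, hs'⟩ := intermediate_value_Icc zero_le_one hψcont
        ⟨by rw [hψ0]; positivity, hn⟩
      exact ⟨s, fun _ => ⟨hs.1, hs'⟩⟩
    · exact ⟨0, fun h => absurd h hn⟩
  choose s hs using hex
  have hsev : ∀ᶠ n in atTop, 0 < s n ∧ ψ (s n) = (n : ℝ)⁻¹ := by
    filter_upwards [hinv.eventually (eventually_le_nhds (hψpos 1 one_pos)),
      eventually_gt_atTop 0] with n hn hn0
    obtain ⟨h1, h2⟩ := hs n hn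
    refine ⟨lt_of_le_of_ne h1 fun h => ?_, h2⟩
    rw [← h, hψ0] at h2
    exact (inv_pos.2 (Nat.cast_pos.2 hn0)).ne h2
  have hs0 : Tendsto s atTop (𝓝[>] 0) := by
    refine tendsto_nhdsWithin_iff.2 ⟨?_, hsev.mono fun n h => h.1⟩
    rw [tendsto_order]
    refine ⟨fun b hb => hsev.mono fun n h => hb.trans h.1, fun b hb => ?_⟩
    filter_upwards [hsev, hinv.eventually (eventually_lt_nhds (hψpos b hb))] with n h h'
    by_contra! hcon
    have := hψmono hb.le (hb.le.trans hcon) hcon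
    rw [h.2] at this
    linarith
  refine ⟨s, hsev.mono fun n h => h.1, fun u hu => ?_⟩
  refine ((hψrat u hu).comp hs0).congr' ?_
  filter_upwards [hsev] with n h
  simp only [Function.comp]
  rw [h.2, div_inv_eq_mul, mul_comm]

end sqLaplace

/-! ### Limits of products of Laplace transforms. -/

/-- Pointwise convergence of monotone functions to a continuous function is uniform on compact
intervals. -/
theorem tendstoUniformlyOn_of_monotoneOn {F : ℕ → ℝ → ℝ} {f : ℝ → ℝ}
    (hF : ∀ᶠ n in atTop, MonotoneOn (F n) (Set.Ioi 0))
    (hlim : ∀ u, 0 < u → Tendsto (fun n => F n u) atTop (𝓝 (f u)))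
    (hf : ContinuousOn f (Set.Ioi 0)) {e k : ℝ} (he : 0 < e) :
    TendstoUniformlyOn F f atTop (Set.Icc e k) := by
  rw [← tendstoLocallyUniformlyOn_iff_tendstoUniformlyOn_of_compact isCompact_Icc,
    Metric.tendstoLocallyUniformlyOn_iff]
  intro ε hε x hx
  have hx0 : 0 < x := he.trans_le hx.1
  have hfx : ContinuousAt f x := hf.continuousAt (Ioi_mem_nhds hx0)
  have hnear : ∀ᶠ y in 𝓝 x, dist (f y) (f x) < ε / 4 :=
    Metric.tendsto_nhds.1 hfx _ (by positivity)
  obtain ⟨δ, hδ, hball⟩ := Metric.eventually_nhds_iff.1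
    (hnear.and (eventually_gt_nhds hx0))
  -- Near `x`, monotonicity traps `F n y` between `F n y₁` and `F n y₂`. Only the two endpoints need
  -- pointwise convergence.
  set y₁ := x - δ / 2
  set y₂ := x + δ / 2
  have h1 := @hball y₁ (by rw [Real.dist_eq]; simp only [y₁]; rw [abs_lt]; constructor <;> linarith)
  have h2 := @hball y₂ (by rw [Real.dist_eq]; simp only [y₂]; rw [abs_lt]; constructor <;> linarith)
  refine ⟨Set.Ioo y₁ y₂, mem_nhdsWithin_of_mem_nhds (Ioo_mem_nhds (by simp only [y₁]; linarith)
    (by simp only [y₂]; linarith)), ?_⟩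
  filter_upwards [hF, Metric.tendsto_nhds.1 (hlim y₁ h1.2) (ε / 4) (by positivity),
    Metric.tendsto_nhds.1 (hlim y₂ h2.2) (ε / 4) (by positivity)] with n hmono hn1 hn2 y hy
  have hy0 : 0 < y := h1.2.trans hy.1
  have hyx : dist y x < δ := by
    rw [Real.dist_eq, abs_lt]; simp only [y₁, y₂] at hy; constructor <;> linarith [hy.1, hy.2]
  have h3 := (hball hyx).1
  have m1 := hmono h1.2 hy0 hy.1.le
  have m2 := hmono hy0 h2.2 hy.2.le
  have h1' := h1.1
  have h2' := h2.1
  rw [Real.dist_eq, abs_lt] at *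
  constructor <;> linarith [h1'.1, h1'.2, h2'.1, h2'.2, h3.1, h3.2, hn1.1, hn1.2, hn2.1, hn2.2]

/-- A consequence of `1 - 1 / y ≤ log y`. It is the counterpart of `1 - x ≤ e^{-x}` that squeezes a
product of factors close to `1` between exponentials of sums. -/
theorem exp_neg_div_le_one_sub {x X : ℝ} (hx : 0 ≤ x) (hxX : x ≤ X) (hX : X < 1) :
    Real.exp (-(x / (1 - X))) ≤ 1 - x := by
  have h1 : 0 < 1 - x := by linarith
  have h2 : 0 < 1 - X := by linarith
  calc Real.exp (-(x / (1 - X))) ≤ Real.exp (-(x / (1 - x))) := by gcongr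
    _ ≤ Real.exp (Real.log (1 - x)) := by
      gcongr
      have := Real.one_sub_inv_le_log_of_pos h1
      have e : 1 - (1 - x)⁻¹ = -(x / (1 - x)) := by field_simp; ring
      linarith
    _ = 1 - x := Real.exp_log h1

/-- Convergence of products of Laplace transforms along the scale `s`. -/
theorem tendsto_prod_sqLaplace {μ : Measure ℝ} [IsProbabilityMeasure μ] {a : ℝ}
    {s : ℕ → ℝ} (hs₀ : ∀ᶠ n in atTop, 0 < s n)
    (hs : ∀ u, 0 < u → Tendsto (fun n : ℕ => n * (1 - sqLaplace μ (s n * u))) atTop (𝓝 (u ^ a)))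
    {c : (n : ℕ) → Fin n → ℝ} {e k m : ℝ} (he : 0 < e)
    (hc : ∀ᶠ n in atTop, ∀ i, c n i ∈ Set.Icc e k)
    (havg : Tendsto (fun n : ℕ => (n : ℝ)⁻¹ * ∑ i, c n i ^ a) atTop (𝓝 m))
    {u : ℝ} (hu : 0 < u) :
    Tendsto (fun n => ∏ i, sqLaplace μ (s n * (u * c n i))) atTop
      (𝓝 (Real.exp (-(u ^ a * m)))) := by
  set F : ℕ → ℝ → ℝ := fun n v => n * (1 - sqLaplace μ (s n * v)) with hFdef
  have hk : 0 < k := by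
    obtain ⟨n, h, hn⟩ := (hc.and (eventually_gt_atTop 0)).exists
    exact he.trans_le ((h ⟨0, hn⟩).1.trans (h ⟨0, hn⟩).2)
  have hmono : ∀ᶠ n in atTop, MonotoneOn (F n) (Set.Ioi 0) := by
    filter_upwards [hs₀] with n hn x hx y hy hxy
    have hx' : 0 < x := hx
    have hy' : 0 < y := hy
    have := sqLaplace_antitoneOn (μ := μ) (a := s n * x) (b := s n * y)
      (Set.mem_Ici.2 (by positivity)) (Set.mem_Ici.2 (by positivity)) (by gcongr)
    simp only [hFdef]
    gcongr
  have hunif := tendstoUniformlyOn_of_monotoneOn hmono hs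
    (fun x (hx : 0 < x) => (Real.continuousAt_rpow_const x a (Or.inl hx.ne')).continuousWithinAt)
    (e := u * e) (k := u * k) (by positivity)
  -- The sum is the empirical average of `F n (u cᵢ)`. Uniform convergence on `[u e, u k]` permits
  -- replacing `F n` by the power `a`, although the points vary with `n`.
  have hsum : Tendsto (fun n : ℕ => ∑ i, (1 - sqLaplace μ (s n * (u * c n i)))) atTop
      (𝓝 (u ^ a * m)) := by
    have h1 : Tendsto (fun n : ℕ => (n : ℝ)⁻¹ * ∑ i, (u * c n i) ^ a) atTop (𝓝 (u ^ a * m)) := by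
      refine (havg.const_mul (u ^ a)).congr' ?_
      filter_upwards [hc] with n hn
      rw [← mul_assoc, mul_comm (u ^ a), mul_assoc, Finset.mul_sum]
      congr 1
      refine Finset.sum_congr rfl fun i _ => ?_
      rw [Real.mul_rpow hu.le (he.le.trans (hn i).1)]
    rw [Metric.tendsto_nhds] at h1 ⊢
    intro ε hε
    filter_upwards [h1 (ε / 2) (by positivity), Metric.tendstoUniformlyOn_iff.1 hunif (ε / 4)
      (by positivity), hc, eventually_gt_atTop 0] with n hn1 hn2 hn3 hn0
    have hn0' : (0 : ℝ) < n := Nat.cast_pos.2 hn0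
    have e1 : ∑ i, (1 - sqLaplace μ (s n * (u * c n i))) = (n : ℝ)⁻¹ * ∑ i, F n (u * c n i) := by
      simp only [hFdef, ← Finset.mul_sum]
      rw [← mul_assoc, inv_mul_cancel₀ hn0'.ne', one_mul]
    have e2 : |(n : ℝ)⁻¹ * ∑ i, F n (u * c n i) - (n : ℝ)⁻¹ * ∑ i, (u * c n i) ^ a| ≤ ε / 4 := by
      rw [← mul_sub, ← Finset.sum_sub_distrib, abs_mul, abs_of_pos (inv_pos.2 hn0')]
      have : |∑ i, (F n (u * c n i) - (u * c n i) ^ a)| ≤ ∑ _i : Fin n, ε / 4 := by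
        refine (Finset.abs_sum_le_sum_abs _ _).trans (Finset.sum_le_sum fun i _ => ?_)
        have := hn2 (u * c n i) ⟨by gcongr; exact (hn3 i).1, by gcongr; exact (hn3 i).2⟩
        rw [dist_comm, Real.dist_eq] at this
        exact this.le
      rw [Finset.sum_const, Finset.card_univ, Fintype.card_fin, nsmul_eq_mul] at this
      rw [inv_mul_le_iff₀ hn0']
      exact this
    rw [e1]
    rw [Real.dist_eq] at hn1 ⊢
    have := abs_sub_le ((n : ℝ)⁻¹ * ∑ i, F n (u * c n i)) ((n : ℝ)⁻¹ * ∑ i, (u * c n i) ^ a)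
      (u ^ a * m)
    linarith
  -- This is `1 - sqLaplace μ (s n * (u * k))`, a common bound for all the summands. Its vanishing
  -- makes the lower and upper exponentials agree in the limit.
  have hX : Tendsto (fun n : ℕ => F n (u * k) * (n : ℝ)⁻¹) atTop (𝓝 0) := by
    simpa using (hs (u * k) (by positivity)).mul tendsto_inv_atTop_nhds_zero_nat
  have hlow : Tendsto (fun n : ℕ => Real.exp (-((∑ i, (1 - sqLaplace μ (s n * (u * c n i)))) /
      (1 - F n (u * k) * (n : ℝ)⁻¹)))) atTop (𝓝 (Real.exp (-(u ^ a * m)))) := by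
    have := (hsum.div (hX.const_sub 1) (by simp)).neg
    rw [sub_zero, div_one] at this
    exact (Real.continuous_exp.tendsto _).comp this
  have hup : Tendsto (fun n : ℕ => Real.exp (-(∑ i, (1 - sqLaplace μ (s n * (u * c n i))))))
      atTop (𝓝 (Real.exp (-(u ^ a * m)))) := (Real.continuous_exp.tendsto _).comp hsum.neg
  refine tendsto_of_tendsto_of_tendsto_of_le_of_le' hlow hup ?_ ?_
  · filter_upwards [hmono, hc, hs₀, eventually_gt_atTop 0,
      hX.eventually (eventually_lt_nhds one_pos)] with n hm hn hsn hn0 hX1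
    have hn0' : (0 : ℝ) < n := Nat.cast_pos.2 hn0
    rw [Finset.sum_div, ← Finset.sum_neg_distrib, Real.exp_sum]
    refine Finset.prod_le_prod (fun i _ => (Real.exp_pos _).le) fun i _ => ?_
    have hci := hn i
    have hci0 : 0 < c n i := he.trans_le hci.1
    have h := hm (a := u * c n i) (b := u * k) (Set.mem_Ioi.2 (by positivity))
      (Set.mem_Ioi.2 (by positivity)) (by gcongr; exact hci.2)
    have := exp_neg_div_le_one_sub (x := 1 - sqLaplace μ (s n * (u * c n i)))
      (X := F n (u * k) * (n : ℝ)⁻¹) (sub_nonneg.2 (sqLaplace_le_one (by positivity))) ?_ hX1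
    · simpa using this
    · rw [← div_eq_mul_inv, le_div_iff₀ hn0', mul_comm]; exact h
  · refine Eventually.of_forall fun n => ?_
    rw [← Finset.sum_neg_distrib, Real.exp_sum]
    refine Finset.prod_le_prod (fun i _ => integral_nonneg fun x => (Real.exp_pos _).le)
      fun i _ => ?_
    have := Real.one_sub_le_exp_neg (1 - sqLaplace μ (s n * (u * c n i)))
    linarith

/-! ### Frullani's formula and expected logarithms of ratios. -/

/-- Truncated Frullani identity. -/
theorem frullani_identity {a p q S B : ℝ} (ha : 0 < a) (hp : 0 < p) (hpq : p ≤ q) (hS : 0 < S)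
    (hB : 0 < B) :
    ∫ s in p..q, (Real.exp (-(s ^ a * S)) - Real.exp (-(s ^ a * B))) / s =
      a⁻¹ * ∫ v in S..B, (Real.exp (-(p ^ a * v)) - Real.exp (-(q ^ a * v))) / v := by
  have hpos : ∀ s ∈ Set.uIcc p q, 0 < s := fun s hs => by
    rw [Set.uIcc_of_le hpq] at hs; exact hp.trans_le hs.1
  have hposv : ∀ v ∈ Set.uIcc S B, 0 < v := fun v hv =>
    (lt_min hS hB).trans_le hv.1
  -- The same kernel `s ^ (a - 1) * exp (-(s ^ a * v))` has explicit primitives in `v` and in `s`.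
  -- The identity is Fubini for this kernel on a rectangle.
  have h1 : ∀ s ∈ Set.uIcc p q, (Real.exp (-(s ^ a * S)) - Real.exp (-(s ^ a * B))) / s =
      ∫ v in S..B, s ^ (a - 1) * Real.exp (-(s ^ a * v)) := by
    intro s hs
    have hs0 := hpos s hs
    have hsa : 0 < s ^ a := Real.rpow_pos_of_pos hs0 a
    rw [intervalIntegral.integral_eq_sub_of_hasDerivAt
      (f := fun v => -(Real.exp (-(s ^ a * v)) / s))]
    · ring
    · intro v _
      have := ((((hasDerivAt_id v).const_mul (s ^ a)).neg.exp).div_const s).neg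
      refine this.congr_deriv ?_
      rw [Real.rpow_sub_one hs0.ne']
      simp only [id, Pi.neg_apply]
      ring
    · exact (by fun_prop : Continuous fun v => s ^ (a - 1) * Real.exp (-(s ^ a * v))).intervalIntegrable _ _
  have h2 : ∀ v ∈ Set.uIcc S B, ∫ s in p..q, s ^ (a - 1) * Real.exp (-(s ^ a * v)) =
      a⁻¹ * ((Real.exp (-(p ^ a * v)) - Real.exp (-(q ^ a * v))) / v) := by
    intro v hv
    have hv0 := hposv v hv
    rw [intervalIntegral.integral_eq_sub_of_hasDerivAt
      (f := fun s => -(a⁻¹ * (Real.exp (-(s ^ a * v)) / v)))]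
    · ring
    · intro s hs
      have hs0 := hpos s hs
      have := ((((((Real.hasDerivAt_rpow_const (p := a) (Or.inl hs0.ne')).mul_const v).neg).exp).div_const
        v).const_mul a⁻¹).neg
      refine this.congr_deriv ?_
      simp only [Pi.neg_apply]
      field_simp
    · refine ContinuousOn.intervalIntegrable fun s hs => ContinuousAt.continuousWithinAt ?_
      have hs0 := hpos s hs
      exact (Real.continuousAt_rpow_const s _ (Or.inl hs0.ne')).mul
        (((Real.continuousAt_rpow_const s _ (Or.inl hs0.ne')).mul continuousAt_const).neg.rexp)
  rw [intervalIntegral.integral_congr h1, ← intervalIntegral.integral_const_mul,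
    ← intervalIntegral.integral_congr h2]
  simp only [intervalIntegral.intervalIntegral_eq_integral_uIoc _ S B]
  rw [intervalIntegral.integral_smul, intervalIntegral_integral_swap]
  rw [Measure.prod_restrict]
  have hcont : ContinuousOn (Function.uncurry fun s v : ℝ => s ^ (a - 1) * Real.exp (-(s ^ a * v)))
      (Set.uIcc p q ×ˢ Set.uIcc S B) := by
    rintro ⟨s, v⟩ ⟨hs, hv⟩
    have hs0 := hpos s hs
    refine ContinuousAt.continuousWithinAt ?_
    have hc : ∀ b : ℝ, ContinuousAt (fun x : ℝ × ℝ => x.1 ^ b) (s, v) := fun b =>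
      continuousAt_fst.rpow_const (Or.inl hs0.ne')
    exact (hc _).mul (((hc _).mul continuousAt_snd).neg.rexp)
  exact (hcont.integrableOn_compact (isCompact_uIcc.prod isCompact_uIcc)).mono_set
    (Set.prod_mono Set.uIoc_subset_uIcc Set.uIoc_subset_uIcc)

/-- Quantitative Frullani formula for the logarithm of a quotient. -/
theorem abs_log_div_sub_frullani_le {a p q S B e k : ℝ} (ha : 0 < a) (hp : 0 < p) (hpq : p ≤ q)
    (he : 0 < e) (hS : S ∈ Set.Icc e k) (hB : B ∈ Set.Icc e k) :
    |a⁻¹ * Real.log (B / S) -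
        ∫ s in p..q, (Real.exp (-(s ^ a * S)) - Real.exp (-(s ^ a * B))) / s| ≤
      a⁻¹ * (Real.log (k / e) * ((1 - Real.exp (-(p ^ a * k))) + Real.exp (-(q ^ a * e)))) := by
  have hS0 : 0 < S := he.trans_le hS.1
  have hB0 : 0 < B := he.trans_le hB.1
  have hk0 : 0 < k := hS0.trans_le hS.2
  have hq : 0 < q := hp.trans_le hpq
  have hpa : 0 ≤ p ^ a := Real.rpow_nonneg hp.le a
  have hqa : 0 ≤ q ^ a := Real.rpow_nonneg hq.le a
  -- The truncation error has integrand `((1 - e^{-p^a v}) + e^{-q^a v}) / v`. Monotonicity on `[e,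
  -- k]` bounds its numerator by `M`.
  set M := (1 - Real.exp (-(p ^ a * k))) + Real.exp (-(q ^ a * e)) with hM
  have hM0 : 0 ≤ M := by
    have : Real.exp (-(p ^ a * k)) ≤ 1 := Real.exp_le_one_iff.2 (by
      have := mul_nonneg hpa hk0.le; linarith)
    have := Real.exp_pos (-(q ^ a * e))
    linarith
  have hposv : ∀ v ∈ Set.uIcc S B, 0 < v := fun v hv => (lt_min hS0 hB0).trans_le hv.1
  have hinv : IntervalIntegrable (fun v : ℝ => v⁻¹) volume S B :=
    ContinuousOn.intervalIntegrable fun v hv =>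
      (continuousAt_inv₀ (hposv v hv).ne').continuousWithinAt
  have hint : IntervalIntegrable
      (fun v : ℝ => (Real.exp (-(p ^ a * v)) - Real.exp (-(q ^ a * v))) / v) volume S B :=
    hinv.continuousOn_mul (by fun_prop :
      Continuous fun v : ℝ => Real.exp (-(p ^ a * v)) - Real.exp (-(q ^ a * v))).continuousOn
  have hlog : ∫ v in S..B, v⁻¹ = Real.log (B / S) := integral_inv_of_pos hS0 hB0
  rw [frullani_identity ha hp hpq hS0 hB0, ← mul_sub, abs_mul, abs_of_pos (inv_pos.2 ha), ← hlog,
    ← intervalIntegral.integral_sub hinv hint]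
  gcongr
  have hb : ‖∫ v in S..B, v⁻¹ - (Real.exp (-(p ^ a * v)) - Real.exp (-(q ^ a * v))) / v‖ ≤
      |∫ v in S..B, M * v⁻¹| := by
    refine intervalIntegral.norm_integral_le_abs_of_norm_le ?_ (hinv.const_mul M)
    refine (ae_restrict_iff' measurableSet_uIoc).2 (Eventually.of_forall fun v hv => ?_)
    have hv' := Set.uIoc_subset_uIcc hv
    have hv0 := hposv v hv'
    have hve : e ≤ v := (le_min hS.1 hB.1).trans hv'.1
    have hvk : v ≤ k := hv'.2.trans (max_le hS.2 hB.2)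
    have e1 : v⁻¹ - (Real.exp (-(p ^ a * v)) - Real.exp (-(q ^ a * v))) / v =
      ((1 - Real.exp (-(p ^ a * v))) + Real.exp (-(q ^ a * v))) * v⁻¹ := by
      field_simp; ring
    have h1 : Real.exp (-(p ^ a * v)) ≤ 1 := Real.exp_le_one_iff.2 (by
      have := mul_nonneg hpa hv0.le; linarith)
    rw [e1, norm_mul, Real.norm_of_nonneg (by linarith [Real.exp_pos (-(q ^ a * v))]),
      Real.norm_of_nonneg (inv_pos.2 hv0).le]
    rw [hM]
    gcongr
  refine hb.trans ?_
  rw [intervalIntegral.integral_const_mul, hlog, abs_mul, abs_of_nonneg hM0, mul_comm]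
  gcongr
  rw [abs_le, ← Real.log_inv]
  constructor
  · refine Real.log_le_log (by positivity) ?_
    rw [inv_div]
    exact div_le_div₀ hB0.le hB.1 hS0 hS.2
  · refine Real.log_le_log (by positivity) ?_
    exact div_le_div₀ hk0.le hB.2 he hS.1

section Product

variable {μ : Measure ℝ} [IsProbabilityMeasure μ]

theorem integral_exp_neg_sum_sq (n : ℕ) (u t : ℝ) (c : Fin n → ℝ) :
    ∫ x, Real.exp (-(u * (t * ∑ i, c i * x i ^ 2))) ∂(Measure.pi fun _ : Fin n => μ) =
      ∏ i, sqLaplace μ (t * (u * c i)) := by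
  unfold sqLaplace
  rw [← integral_fintype_prod_eq_prod]
  refine integral_congr_ae (Eventually.of_forall fun x => ?_)
  simp only
  rw [← Real.exp_sum, Finset.mul_sum, Finset.mul_sum, ← Finset.sum_neg_distrib]
  congr 1
  refine Finset.sum_congr rfl fun i _ => ?_
  ring

theorem sum_mul_sq_mem {n : ℕ} {c : Fin n → ℝ} {e k : ℝ} (hc : ∀ i, c i ∈ Set.Icc e k)
    (x : Fin n → ℝ) :
    ∑ i, c i * x i ^ 2 ∈ Set.Icc (e * ∑ i, x i ^ 2) (k * ∑ i, x i ^ 2) := by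
  rw [Finset.mul_sum, Finset.mul_sum]
  exact ⟨Finset.sum_le_sum fun i _ => by gcongr; exact (hc i).1,
    Finset.sum_le_sum fun i _ => by gcongr; exact (hc i).2⟩

theorem integrable_log_ratio {n : ℕ} {c : Fin n → ℝ} {e k : ℝ} (he : 0 < e)
    (he1 : e ≤ 1) (hk1 : 1 ≤ k) (hc : ∀ i, c i ∈ Set.Icc e k) :
    Integrable (fun x : Fin n → ℝ => Real.log ((∑ i, c i * x i ^ 2) / ∑ i, x i ^ 2))
      (Measure.pi fun _ : Fin n => μ) := by
  have hk : 0 < k := one_pos.trans_le hk1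
  have hΛ : 0 ≤ Real.log (k / e) := Real.log_nonneg (by rw [le_div_iff₀ he]; linarith)
  refine Integrable.of_bound (C := Real.log (k / e)) (by
    refine Measurable.aestronglyMeasurable ?_
    fun_prop) (Eventually.of_forall fun x => ?_)
  have hmem := sum_mul_sq_mem hc x
  have hS0 : 0 ≤ ∑ i, x i ^ 2 := Finset.sum_nonneg fun i _ => sq_nonneg _
  rcases hS0.eq_or_lt with h | h
  · rw [← h]; simpa using hΛ
  · have h1 : e ≤ (∑ i, c i * x i ^ 2) / ∑ i, x i ^ 2 := by rw [le_div_iff₀ h]; exact hmem.1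
    have h2 : (∑ i, c i * x i ^ 2) / ∑ i, x i ^ 2 ≤ k := by rw [div_le_iff₀ h]; exact hmem.2
    have h3 := Real.log_le_log he h1
    have h4 := Real.log_le_log (he.trans_le h1) h2
    rw [Real.log_div hk.ne' he.ne', Real.norm_eq_abs, abs_le]
    have h5 := Real.log_nonneg hk1
    have h6 := Real.log_nonpos he.le he1
    constructor <;> linarith

/-- The truncated Frullani formula with exponent `1` is integrated over the product law. Fubini and
independence turn both the main term and the error into products of Laplace transforms. The factor
`t` leaves the ratio unchanged, so the normalizing scale can be inserted freely. -/
theorem abs_integral_log_sub_frullani_le {n : ℕ} {c : Fin n → ℝ} {e k p q t : ℝ} (he : 0 < e)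
    (he1 : e ≤ 1) (hk1 : 1 ≤ k) (hc : ∀ i, c i ∈ Set.Icc e k) (hp : 0 < p) (hpq : p ≤ q)
    (ht : 0 < t) :
    |∫ x, Real.log ((∑ i, c i * x i ^ 2) / ∑ i, x i ^ 2) ∂(Measure.pi fun _ : Fin n => μ) -
        ∫ u in p..q, ((∏ _i : Fin n, sqLaplace μ (t * (u * 1))) -
          ∏ i, sqLaplace μ (t * (u * c i))) / u| ≤
      Real.log (k / e) * ((1 - ∏ _i : Fin n, sqLaplace μ (t * (p * k))) +
        ∏ _i : Fin n, sqLaplace μ (t * (q * e))) := by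
  set P := Measure.pi fun _ : Fin n => μ with hP
  have hk : 0 < k := one_pos.trans_le hk1
  have hΛ : 0 ≤ Real.log (k / e) := Real.log_nonneg (by rw [le_div_iff₀ he]; linarith)
  have hpt : ∀ x : Fin n → ℝ, |Real.log ((∑ i, c i * x i ^ 2) / ∑ i, x i ^ 2) -
      ∫ u in p..q, (Real.exp (-(u * (t * ∑ i, 1 * x i ^ 2))) -
        Real.exp (-(u * (t * ∑ i, c i * x i ^ 2)))) / u| ≤
      Real.log (k / e) * ((1 - Real.exp (-(p * (t * ∑ i, k * x i ^ 2)))) +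
        Real.exp (-(q * (t * ∑ i, e * x i ^ 2)))) := by
    intro x
    have hmem := sum_mul_sq_mem hc x
    simp only [one_mul, ← Finset.mul_sum]
    have hS0 : 0 ≤ ∑ i, x i ^ 2 := Finset.sum_nonneg fun i _ => sq_nonneg _
    -- For the null vector the logarithm is `log (0 / 0) = 0` and the Frullani integral is `0`, so
    -- the bound holds trivially.
    rcases hS0.eq_or_lt with h | h
    · rw [← h] at hmem ⊢
      simp only [mul_zero, Set.Icc_self, Set.mem_singleton_iff] at hmem
      simp [hmem, hΛ]
    -- The bounds `e`, `k` are scaled by the random sum `t ∑ xᵢ²`. The assumption `e ≤ 1 ≤ k` puts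
    -- the denominator in the same range as the numerator, and the ratio of the bounds remains `k /
    -- e`.
    · have := abs_log_div_sub_frullani_le (a := 1) (p := p) (q := q)
        (S := t * ∑ i, x i ^ 2) (B := t * ∑ i, c i * x i ^ 2) (e := t * (e * ∑ i, x i ^ 2))
        (k := t * (k * ∑ i, x i ^ 2)) one_pos hp hpq (by positivity)
        ⟨by gcongr; exact mul_le_of_le_one_left hS0 he1,
          by gcongr; exact le_mul_of_one_le_left hS0 hk1⟩
        ⟨by gcongr; exact hmem.1, by gcongr; exact hmem.2⟩
      simp only [inv_one, one_mul, Real.rpow_one] at this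
      rwa [mul_div_mul_left _ _ ht.ne', mul_div_mul_left _ _ ht.ne',
        mul_div_mul_right _ _ h.ne'] at this
  have hint : ∀ u, 0 < u → ∀ b : Fin n → ℝ, (∀ i, 0 < b i) →
      Integrable (fun x : Fin n → ℝ => Real.exp (-(u * (t * ∑ i, b i * x i ^ 2)))) P := by
    intro u hu b hb
    refine Integrable.of_bound (C := 1) (Measurable.aestronglyMeasurable (by fun_prop))
      (Eventually.of_forall fun x => ?_)
    rw [Real.norm_of_nonneg (Real.exp_nonneg _), Real.exp_le_one_iff, neg_nonpos]
    have : 0 ≤ ∑ i, b i * x i ^ 2 :=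
      Finset.sum_nonneg fun i _ => mul_nonneg (hb i).le (sq_nonneg _)
    positivity
  have hc0 : ∀ i, 0 < c i := fun i => he.trans_le (hc i).1
  have hf : Integrable (Function.uncurry fun (u : ℝ) (x : Fin n → ℝ) =>
      (Real.exp (-(u * (t * ∑ i, 1 * x i ^ 2))) -
        Real.exp (-(u * (t * ∑ i, c i * x i ^ 2)))) / u)
      ((volume.restrict (Set.uIoc p q)).prod P) := by
    have : IsFiniteMeasure (volume.restrict (Set.uIoc p q)) :=
      ⟨by rw [Measure.restrict_apply_univ, Set.uIoc_of_le hpq]; simp⟩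
    refine Integrable.of_bound (C := 1 / p) ?_ ?_
    · refine Measurable.aestronglyMeasurable ?_
      simp only [Function.uncurry_def]
      fun_prop
    · have : ∀ᵐ z ∂(volume.restrict (Set.uIoc p q)).prod P, z.1 ∈ Set.uIoc p q := by
        refine Measure.quasiMeasurePreserving_fst.ae ?_
        exact ae_restrict_mem measurableSet_uIoc
      filter_upwards [this] with z hz
      rw [Set.uIoc_of_le hpq] at hz
      have hz0 : 0 < z.1 := hp.trans hz.1
      simp only [Function.uncurry]
      rw [norm_div, Real.norm_of_nonneg hz0.le]
      refine div_le_div₀ zero_le_one ?_ hp hz.1.le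
      have hb : ∀ b : Fin n → ℝ, (∀ i, 0 < b i) →
          0 < Real.exp (-(z.1 * (t * ∑ i, b i * z.2 i ^ 2))) ∧
          Real.exp (-(z.1 * (t * ∑ i, b i * z.2 i ^ 2))) ≤ 1 := by
        intro b hb
        refine ⟨Real.exp_pos _, ?_⟩
        rw [Real.exp_le_one_iff, neg_nonpos]
        have : 0 ≤ ∑ i, b i * z.2 i ^ 2 :=
          Finset.sum_nonneg fun i _ => mul_nonneg (hb i).le (sq_nonneg _)
        positivity
      have h1 := hb (fun _ => 1) (fun _ => one_pos)
      have h2 := hb c hc0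
      rw [Real.norm_eq_abs, abs_le]
      constructor <;> linarith [h1.1, h1.2, h2.1, h2.2]
  have hswap := intervalIntegral_integral_swap hf
  have hleft : ∀ u ∈ Set.uIcc p q, ((∏ _i : Fin n, sqLaplace μ (t * (u * 1))) -
      ∏ i, sqLaplace μ (t * (u * c i))) / u =
      ∫ x, (Real.exp (-(u * (t * ∑ i, 1 * x i ^ 2))) -
        Real.exp (-(u * (t * ∑ i, c i * x i ^ 2)))) / u ∂P := by
    intro u hu
    rw [Set.uIcc_of_le hpq] at hu
    have hu0 : 0 < u := hp.trans_le hu.1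
    rw [integral_div, integral_sub (hint u hu0 (fun _ => 1) fun _ => one_pos) (hint u hu0 c hc0),
      integral_exp_neg_sum_sq, integral_exp_neg_sum_sq]
  have hlogint := integrable_log_ratio (μ := μ) he he1 hk1 hc
  have hintint : Integrable (fun x : Fin n → ℝ => ∫ u in p..q,
      (Real.exp (-(u * (t * ∑ i, 1 * x i ^ 2))) -
        Real.exp (-(u * (t * ∑ i, c i * x i ^ 2)))) / u) P := by
    rw [Set.uIoc_of_le hpq] at hf
    simp only [intervalIntegral.integral_of_le hpq]
    exact hf.integral_prod_right
  rw [intervalIntegral.integral_congr hleft, hswap, ← integral_sub hlogint hintint,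
    ← Real.norm_eq_abs]
  have hp1 := hint p hp (fun _ => k) fun _ => hk
  have hq1 := hint q (hp.trans_le hpq) (fun _ => e) fun _ => he
  have hp2 : Integrable (fun x : Fin n → ℝ => 1 - Real.exp (-(p * (t * ∑ i, k * x i ^ 2)))) P :=
    (integrable_const 1).sub hp1
  refine (norm_integral_le_of_norm_le (g := fun x : Fin n → ℝ =>
    Real.log (k / e) * ((1 - Real.exp (-(p * (t * ∑ i, k * x i ^ 2)))) +
        Real.exp (-(q * (t * ∑ i, e * x i ^ 2))))) ?_ (Eventually.of_forall hpt)).trans_eq ?_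
  · exact (hp2.add hq1).const_mul _
  · rw [integral_const_mul, integral_add hp2 hq1,
      integral_sub (integrable_const 1) hp1, integral_exp_neg_sum_sq, integral_exp_neg_sum_sq]
    simp [hP]

/-- Convergence of the expected logarithm of a ratio of weighted sums of squares. -/
theorem tendsto_integral_log_ratio {a : ℝ} (ha₀ : 0 < a)
    {s : ℕ → ℝ} (hs₀ : ∀ᶠ n in atTop, 0 < s n)
    (hs : ∀ u, 0 < u → Tendsto (fun n : ℕ => n * (1 - sqLaplace μ (s n * u))) atTop (𝓝 (u ^ a)))
    {c : (n : ℕ) → Fin n → ℝ} {e k m : ℝ} (he : 0 < e) (he1 : e ≤ 1) (hk1 : 1 ≤ k)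
    (hc : ∀ᶠ n in atTop, ∀ i, c n i ∈ Set.Icc e k)
    (havg : Tendsto (fun n : ℕ => (n : ℝ)⁻¹ * ∑ i, c n i ^ a) atTop (𝓝 m)) :
    Tendsto (fun n : ℕ => ∫ x, Real.log ((∑ i, c n i * x i ^ 2) / ∑ i, x i ^ 2)
      ∂(Measure.pi fun _ : Fin n => μ)) atTop (𝓝 (a⁻¹ * Real.log m)) := by
  have hk : 0 < k := one_pos.trans_le hk1
  have hΛ : 0 ≤ Real.log (k / e) := Real.log_nonneg (by rw [le_div_iff₀ he]; linarith)
  have hconst : ∀ b : ℝ, Tendsto (fun n : ℕ => (n : ℝ)⁻¹ * ∑ _i : Fin n, b ^ a) atTop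
      (𝓝 (b ^ a)) := by
    intro b
    refine tendsto_const_nhds.congr' ?_
    filter_upwards [eventually_gt_atTop 0] with n hn
    have : (n : ℝ) ≠ 0 := (Nat.cast_pos.2 hn).ne'
    simp [this]
  have hm : m ∈ Set.Icc (e ^ a) (k ^ a) := by
    refine ⟨le_of_tendsto_of_tendsto (hconst e) havg ?_,
      le_of_tendsto_of_tendsto havg (hconst k) ?_⟩
    all_goals
      filter_upwards [hc] with n hn
      gcongr with i
    · exact (hn i).1
    · exact he.le.trans (hn i).1
    · exact (hn i).2
  -- The limiting truncation error for the window `[q⁻¹, q]`. The window is fixed with `r q < ε / 3`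
  -- before `n` grows.
  set r : ℝ → ℝ := fun q => Real.log (k / e) *
    ((1 - Real.exp (-((q⁻¹ * k) ^ a * 1))) + Real.exp (-((q * e) ^ a * 1))) with hr
  have hr0 : Tendsto r atTop (𝓝 0) := by
    have h1 : Tendsto (fun q : ℝ => (q⁻¹ * k) ^ a * 1) atTop (𝓝 0) := by
      have h : Tendsto (fun q : ℝ => q⁻¹ * k) atTop (𝓝 0) := by
        simpa using tendsto_inv_atTop_zero.mul_const k
      simpa [Real.zero_rpow ha₀.ne'] using h.rpow_const (p := a) (Or.inr ha₀.le)
    have h2 : Tendsto (fun q : ℝ => (q * e) ^ a * 1) atTop atTop := by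
      simp only [mul_one]
      exact (tendsto_rpow_atTop ha₀).comp (tendsto_id.atTop_mul_const he)
    have h3 := ((Real.continuous_exp.tendsto _).comp h1.neg).const_sub 1
    have h4 := Real.tendsto_exp_neg_atTop_nhds_zero.comp h2
    simpa [hr] using (h3.add h4).const_mul (Real.log (k / e))
  rw [Metric.tendsto_nhds]
  intro ε hε
  obtain ⟨q, hrq, hq1⟩ := ((hr0.eventually (eventually_lt_nhds (show 0 < ε / 3 by positivity))).and
    (eventually_ge_atTop 1)).exists
  have hq : 0 < q := one_pos.trans_le hq1
  have hp : 0 < q⁻¹ := inv_pos.2 hq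
  have hpq : q⁻¹ ≤ q := (inv_le_one_of_one_le₀ hq1).trans hq1
  have hprod : ∀ (b : ℝ), 0 < b → ∀ u, 0 < u →
      Tendsto (fun n => ∏ _i : Fin n, sqLaplace μ (s n * (u * b))) atTop
        (𝓝 (Real.exp (-(u ^ a * b ^ a)))) := fun b hb u hu =>
    tendsto_prod_sqLaplace hs₀ hs (c := fun n _ => b) (e := b) (k := b) hb
      (Eventually.of_forall fun n _ => ⟨le_rfl, le_rfl⟩) (hconst b) hu
  have hbound : Tendsto (fun n : ℕ => Real.log (k / e) *
      ((1 - ∏ _i : Fin n, sqLaplace μ (s n * (q⁻¹ * k))) +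
        ∏ _i : Fin n, sqLaplace μ (s n * (q * e)))) atTop (𝓝 (r q)) := by
    have h1 := hprod k hk q⁻¹ hp
    have h2 := hprod e he q hq
    rw [← Real.mul_rpow hp.le hk.le, ← mul_one ((q⁻¹ * k) ^ a)] at h1
    rw [← Real.mul_rpow hq.le he.le, ← mul_one ((q * e) ^ a)] at h2
    exact ((h1.const_sub 1).add h2).const_mul _
  have hJ : Tendsto (fun n : ℕ => ∫ u in q⁻¹..q, ((∏ _i : Fin n, sqLaplace μ (s n * (u * 1))) -
      ∏ i, sqLaplace μ (s n * (u * c n i))) / u) atTop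
      (𝓝 (∫ u in q⁻¹..q, (Real.exp (-(u ^ a * 1)) - Real.exp (-(u ^ a * m))) / u)) := by
    have hprod01 : ∀ n : ℕ, ∀ b : Fin n → ℝ, (∀ i, 0 ≤ b i) →
        0 ≤ ∏ i, sqLaplace μ (b i) ∧ ∏ i, sqLaplace μ (b i) ≤ 1 := fun n b hb =>
      ⟨Finset.prod_nonneg fun i _ => integral_nonneg fun x => (Real.exp_pos _).le,
        Finset.prod_le_one (fun i _ => integral_nonneg fun x => (Real.exp_pos _).le)
          fun i _ => sqLaplace_le_one (hb i)⟩
    refine intervalIntegral.tendsto_integral_filter_of_dominated_convergence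
      (fun u => 1 / q⁻¹) ?_ ?_ intervalIntegrable_const ?_
    · filter_upwards [hs₀, hc] with n hn hcn
      refine ContinuousOn.aestronglyMeasurable ?_ measurableSet_uIoc
      have hcont : ∀ b, 0 ≤ b → ContinuousOn (fun u => sqLaplace μ (s n * (u * b)))
          (Set.uIoc q⁻¹ q) := by
        intro b hb
        refine continuousOn_sqLaplace.comp (by fun_prop) fun u hu => ?_
        rw [Set.uIoc_of_le hpq] at hu
        have : 0 < u := hp.trans hu.1
        exact Set.mem_Ici.2 (by positivity)
      refine ContinuousOn.div (ContinuousOn.sub ?_ ?_) continuousOn_id fun u hu => ?_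
      · exact continuousOn_finsetProd _ fun i _ => hcont 1 zero_le_one
      · exact continuousOn_finsetProd _ fun i _ => hcont _ (he.le.trans (hcn i).1)
      · rw [Set.uIoc_of_le hpq] at hu
        exact (hp.trans hu.1).ne'
    · filter_upwards [hs₀, hc] with n hn hcn
      refine Eventually.of_forall fun u hu => ?_
      rw [Set.uIoc_of_le hpq] at hu
      have hu0 : 0 < u := hp.trans hu.1
      rw [norm_div, Real.norm_of_nonneg hu0.le]
      refine div_le_div₀ zero_le_one ?_ hp hu.1.le
      have h1 := hprod01 n (fun _ => s n * (u * 1)) fun _ => by positivity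
      have h2 := hprod01 n (fun i => s n * (u * c n i)) fun i => by
        have := he.le.trans (hcn i).1
        positivity
      rw [Real.norm_eq_abs, abs_le]
      constructor <;> linarith [h1.1, h1.2, h2.1, h2.2]
    · refine Eventually.of_forall fun u hu => ?_
      rw [Set.uIoc_of_le hpq] at hu
      have hu0 : 0 < u := hp.trans hu.1
      have h1 := hprod 1 one_pos u hu0
      rw [Real.one_rpow] at h1
      exact (h1.sub (tendsto_prod_sqLaplace hs₀ hs he hc havg hu0)).div_const u
  -- Frullani again, now with exponent `a`, to evaluate the limiting integral. Since `a⁻¹ log (k^a /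
  -- e^a) = log (k / e)`, its error is the same `r q`.
  have hI := abs_log_div_sub_frullani_le (a := a) (p := q⁻¹) (q := q) (S := 1) (B := m)
    (e := e ^ a) (k := k ^ a) ha₀ hp hpq (Real.rpow_pos_of_pos he a)
    ⟨Real.rpow_le_one he.le he1 ha₀.le, Real.one_le_rpow hk1 ha₀.le⟩ hm
  have hIr : a⁻¹ * (Real.log (k ^ a / e ^ a) * ((1 - Real.exp (-(q⁻¹ ^ a * k ^ a))) +
      Real.exp (-(q ^ a * e ^ a)))) = r q := by
    rw [← Real.div_rpow hk.le he.le, Real.log_rpow (by positivity), ← Real.mul_rpow hp.le hk.le,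
      ← Real.mul_rpow hq.le he.le, hr]
    field_simp
  rw [hIr, div_one] at hI
  filter_upwards [hbound.eventually (eventually_lt_nhds hrq), Metric.tendsto_nhds.1 hJ (ε / 3)
    (by positivity), hs₀, hc] with n h1 h2 hsn hcn
  have h3 := abs_integral_log_sub_frullani_le (μ := μ) he he1 hk1 hcn hp hpq hsn
  rw [Real.dist_eq] at h2 ⊢
  rw [abs_lt] at h2 ⊢
  rw [abs_le] at h3 hI
  constructor <;> linarith [h2.1, h2.2, h3.1, h3.2, hI.1, hI.2]

end Product

/-! ### Measures on a compact interval and their transforms. -/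

theorem integral_pos_of_ae_pos {Ω : Type*} [MeasurableSpace Ω] {ρ : Measure Ω}
    [IsProbabilityMeasure ρ] {f : Ω → ℝ} (hf : Integrable f ρ) (hpos : ∀ᵐ x ∂ρ, 0 < f x) :
    0 < ∫ x, f x ∂ρ := by
  have h0 : 0 ≤ᵐ[ρ] f := hpos.mono fun x hx => hx.le
  refine lt_of_le_of_ne (integral_nonneg_of_ae h0) fun h => ?_
  have h1 := (integral_eq_zero_iff_of_nonneg_ae h0 hf).1 h.symm
  obtain ⟨x, hx, hx'⟩ := (hpos.and h1).exists
  exact hx.ne' hx'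

theorem integrable_of_ae_mem_compact {E : Type*} [NormedAddCommGroup E] {ρ : Measure ℝ}
    [IsFiniteMeasure ρ] {K : Set ℝ} (hK : IsCompact K) (hρ : ∀ᵐ x ∂ρ, x ∈ K) {f : ℝ → E}
    (hfm : AEStronglyMeasurable f ρ) (hf : ContinuousOn f K) : Integrable f ρ := by
  obtain ⟨C, hC⟩ := hK.exists_bound_of_continuousOn hf
  exact Integrable.of_bound hfm C (hρ.mono hC)

/-- Differentiation of `z ↦ ∫ g (z - x) ρ(dx)` for a measure carried by a compact set. -/
theorem hasDerivAt_integral_comp_sub {𝕜 : Type*} [RCLike 𝕜] {ρ : Measure ℝ}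
    [IsFiniteMeasure ρ] {K : Set ℝ} (hK : IsCompact K) (hρ : ∀ᵐ x ∂ρ, x ∈ K) {U : Set 𝕜}
    (hU : IsOpen U) {g g' : 𝕜 → 𝕜} (hg : ∀ y ∈ U, HasDerivAt g (g' y) y)
    (hg' : ContinuousOn g' U) (hgm : Measurable g) (hgm' : Measurable g') {z : 𝕜}
    (hz : ∀ x ∈ K, z - (x : 𝕜) ∈ U) :
    HasDerivAt (fun w : 𝕜 => ∫ x, g (w - (x : 𝕜)) ∂ρ) (∫ x, g' (z - (x : 𝕜)) ∂ρ) z := by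
  have hcont : Continuous fun x : ℝ => z - (x : 𝕜) := by fun_prop
  have hK₁ := hK.image hcont
  -- A compact thickening of `z - K` inside `U` bounds `g'` uniformly for `w` within `δ` of `z`;
  -- this constant dominates the derivatives.
  obtain ⟨δ, hδ, hsub⟩ := hK₁.exists_cthickening_subset_open hU
    (Set.image_subset_iff.2 hz)
  have hT := hK₁.cthickening (r := δ)
  obtain ⟨C, hC⟩ := hT.exists_bound_of_continuousOn (hg'.mono hsub)
  have hgc : ContinuousOn g U := fun y hy => (hg y hy).continuousAt.continuousWithinAt
  obtain ⟨C₀, hC₀⟩ := hT.exists_bound_of_continuousOn (hgc.mono hsub)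
  have hmem : ∀ x ∈ K, ∀ w ∈ Metric.ball z δ, w - (x : 𝕜) ∈
      Metric.cthickening δ ((fun x : ℝ => z - (x : 𝕜)) '' K) := by
    intro x hx w hw
    refine Metric.mem_cthickening_of_dist_le _ _ _ _ (Set.mem_image_of_mem _ hx) ?_
    rw [dist_sub_right]
    exact (Metric.mem_ball.1 hw).le
  have hm : Measurable fun x : ℝ => (x : 𝕜) := RCLike.measurable_ofReal
  refine (hasDerivAt_integral_of_dominated_loc_of_deriv_le (bound := fun _ => C)
    (F' := fun w (x : ℝ) => g' (w - (x : 𝕜)))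
    (Metric.ball_mem_nhds z hδ) ?_ ?_ ?_ ?_ (integrable_const (μ := ρ) C) ?_).2
  · exact Eventually.of_forall fun w => (hgm.comp (hm.const_sub w)).aestronglyMeasurable
  · refine Integrable.of_bound (C := C₀) (hgm.comp (hm.const_sub z)).aestronglyMeasurable ?_
    filter_upwards [hρ] with x hx
    exact hC₀ _ (hmem x hx z (Metric.mem_ball_self hδ))
  · exact (hgm'.comp (hm.const_sub z)).aestronglyMeasurable
  · filter_upwards [hρ] with x hx w hw
    exact hC _ (hmem x hx w hw)
  · filter_upwards [hρ] with x hx w hw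
    have := (hg _ (hsub (hmem x hx w hw))).comp w ((hasDerivAt_id w).sub_const (x : 𝕜))
    rw [mul_one] at this
    exact this

/-- A function which is continuous on a compact interval agrees there with a bounded continuous
function. -/
theorem exists_boundedContinuous_eqOn {l r : ℝ} (hlr : l ≤ r) {φ : ℝ → ℝ}
    (hφ : ContinuousOn φ (Set.Icc l r)) : ∃ f : ℝ →ᵇ ℝ, ∀ x ∈ Set.Icc l r, f x = φ x := by
  refine ⟨(BoundedContinuousFunction.mkOfCompact
    ⟨_, continuousOn_iff_continuous_domRestrict.1 hφ⟩).compContinuous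
    ⟨Set.projIcc l r hlr, continuous_projIcc⟩, fun x hx => ?_⟩
  simp [Set.projIcc_of_mem hlr hx]

/-- A weak limit of averages over points of a compact interval is carried by the interval. -/
theorem ae_mem_Icc_of_tendsto {ι : Type*} {F : Filter ι} [F.NeBot] {l r : ℝ} (hlr : l ≤ r)
    {ρ : Measure ℝ} [IsFiniteMeasure ρ] {Φ : ι → (ℝ → ℝ) → ℝ}
    (hΦ : ∀ f : ℝ → ℝ, (∀ x ∈ Set.Icc l r, f x = 0) → ∀ᶠ i in F, Φ i f = 0)
    (hlim : ∀ f : ℝ →ᵇ ℝ, Tendsto (fun i => Φ i f) F (𝓝 (∫ x, f x ∂ρ))) :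
    ∀ᵐ x ∂ρ, x ∈ Set.Icc l r := by
  let f : ℝ →ᵇ ℝ := BoundedContinuousFunction.ofNormedAddCommGroup
    (fun x => min 1 (Metric.infDist x (Set.Icc l r)))
    (continuous_const.min (Metric.continuous_infDist_pt _)) 1 fun x => by
      rw [Real.norm_of_nonneg (le_min zero_le_one Metric.infDist_nonneg)]
      exact min_le_left _ _
  have hf : ∀ x, f x = min 1 (Metric.infDist x (Set.Icc l r)) := fun x => rfl
  have h0 : ∫ x, f x ∂ρ = 0 := by
    refine tendsto_nhds_unique (hlim f) (tendsto_const_nhds.congr' ?_)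
    filter_upwards [hΦ f fun x hx => by rw [hf, Metric.infDist_zero_of_mem hx]; simp] with i hi
    exact hi.symm
  have hf0 : 0 ≤ ⇑f := fun x => le_min zero_le_one Metric.infDist_nonneg
  rw [integral_eq_zero_iff_of_nonneg hf0 (f.integrable ρ)] at h0
  filter_upwards [h0] with x hx
  rw [Pi.zero_apply, hf] at hx
  rw [isClosed_Icc.mem_iff_infDist_zero (Set.nonempty_Icc.2 hlr)]
  have := Metric.infDist_nonneg (x := x) (s := Set.Icc l r)
  by_contra h
  have h' : 0 < Metric.infDist x (Set.Icc l r) := lt_of_le_of_ne this (Ne.symm h)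
  exact (lt_min one_pos h').ne' hx

/-- Two probability measures on a compact interval whose Stieltjes transforms agree near `+∞`
are equal. -/
theorem eq_of_real_stieltjes_eq {ρ ρ' : Measure ℝ} [IsProbabilityMeasure ρ]
    [IsProbabilityMeasure ρ'] {C : ℝ} (hC : 0 < C) (hρ : ∀ᵐ x ∂ρ, x ∈ Set.Icc (-C) C)
    (hρ' : ∀ᵐ x ∂ρ', x ∈ Set.Icc (-C) C)
    (h : ∀ z, C < z → ∫ x, (z - x)⁻¹ ∂ρ = ∫ x, (z - x)⁻¹ ∂ρ') : ρ = ρ' := by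
  have hpowint : ∀ (k : ℕ) (τ : Measure ℝ) [IsProbabilityMeasure τ],
      (∀ᵐ x ∂τ, x ∈ Set.Icc (-C) C) → Integrable (fun x => x ^ k) τ := by
    intro k τ _ hτ
    refine Integrable.of_bound (C := C ^ k) (by fun_prop) ?_
    filter_upwards [hτ] with x hx
    rw [norm_pow]
    gcongr
    exact abs_le.2 hx
  have hresint : ∀ (k : ℕ) (z : ℝ), C < z → ∀ (τ : Measure ℝ) [IsProbabilityMeasure τ],
      (∀ᵐ x ∂τ, x ∈ Set.Icc (-C) C) → Integrable (fun x => x ^ k * (z - x)⁻¹) τ := by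
    intro k z hz τ _ hτ
    refine Integrable.of_bound (C := C ^ k * (z - C)⁻¹)
      (Measurable.aestronglyMeasurable (by fun_prop)) ?_
    filter_upwards [hτ] with x hx
    have hzC : 0 < z - C := by linarith
    have h1 : z - C ≤ z - x := by linarith [hx.2]
    have h2 : 0 < z - x := hzC.trans_le h1
    rw [norm_mul, norm_pow, norm_inv, Real.norm_of_nonneg (hzC.le.trans h1)]
    gcongr
    exact abs_le.2 hx
  -- Moments are recovered one at a time: this limit reads off the `k`-th moment, and `hrec` passes
  -- from `x^k / (z - x)` to `x^(k+1) / (z - x)`. Weierstrass approximation then reaches all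
  -- continuous test functions.
  have hmomlim : ∀ (k : ℕ) (τ : Measure ℝ) [IsProbabilityMeasure τ],
      (∀ᵐ x ∂τ, x ∈ Set.Icc (-C) C) →
      Tendsto (fun z : ℝ => z * ∫ x, x ^ k * (z - x)⁻¹ ∂τ) atTop (𝓝 (∫ x, x ^ k ∂τ)) := by
    intro k τ _ hτ
    simp_rw [← integral_const_mul]
    refine tendsto_integral_filter_of_dominated_convergence (fun _ => C ^ k * 2) ?_ ?_
      (integrable_const _) ?_
    · exact Eventually.of_forall fun z => Measurable.aestronglyMeasurable (by fun_prop)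
    · filter_upwards [eventually_gt_atTop (2 * C)] with z hz
      filter_upwards [hτ] with x hx
      have hz0 : 0 < z := by linarith
      have h1 : z / 2 ≤ z - x := by linarith [hx.2]
      have h2 : 0 < z - x := by linarith
      have e : z * (x ^ k * (z - x)⁻¹) = x ^ k * (z / (z - x)) := by ring
      rw [e, norm_mul, norm_pow, Real.norm_of_nonneg (div_pos hz0 h2).le]
      gcongr
      · exact abs_le.2 hx
      · rw [div_le_iff₀ h2]; linarith
    · refine Eventually.of_forall fun x => ?_
      have h1 : Tendsto (fun z : ℝ => z / (z - x)) atTop (𝓝 1) := by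
        have h2 : Tendsto (fun z : ℝ => (1 - x / z)⁻¹) atTop (𝓝 1) := by
          have := ((tendsto_const_nhds (x := x)).div_atTop tendsto_id).const_sub (1 : ℝ)
          rw [sub_zero] at this
          simpa using this.inv₀ one_ne_zero
        refine h2.congr' ?_
        filter_upwards [eventually_gt_atTop 0, eventually_gt_atTop x] with z hz hzx
        have : z - x ≠ 0 := by linarith
        field_simp
      refine ((h1.const_mul (x ^ k)).congr fun z => ?_).trans_eq (by rw [mul_one])
      ring
  have hrec : ∀ (k : ℕ) (z : ℝ), C < z → ∀ (τ : Measure ℝ) [IsProbabilityMeasure τ],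
      (∀ᵐ x ∂τ, x ∈ Set.Icc (-C) C) →
      ∫ x, x ^ (k + 1) * (z - x)⁻¹ ∂τ = z * (∫ x, x ^ k * (z - x)⁻¹ ∂τ) - ∫ x, x ^ k ∂τ := by
    intro k z hz τ _ hτ
    rw [← integral_const_mul, ← integral_sub ((hresint k z hz τ hτ).const_mul z)
      (hpowint k τ hτ)]
    refine integral_congr_ae ?_
    filter_upwards [hτ] with x hx
    have : z - x ≠ 0 := by linarith [hx.2]
    field_simp
    ring
  have hmom : ∀ k : ℕ, (∀ z, C < z → ∫ x, x ^ k * (z - x)⁻¹ ∂ρ = ∫ x, x ^ k * (z - x)⁻¹ ∂ρ') ∧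
      ∫ x, x ^ k ∂ρ = ∫ x, x ^ k ∂ρ' := by
    have hstep : ∀ k : ℕ, (∀ z, C < z → ∫ x, x ^ k * (z - x)⁻¹ ∂ρ = ∫ x, x ^ k * (z - x)⁻¹ ∂ρ') →
        ∫ x, x ^ k ∂ρ = ∫ x, x ^ k ∂ρ' := by
      intro k hk
      refine tendsto_nhds_unique ((hmomlim k ρ hρ).congr' ?_) (hmomlim k ρ' hρ')
      filter_upwards [eventually_gt_atTop C] with z hz
      rw [hk z hz]
    intro k
    induction k with
    | zero =>
      have h0 : ∀ z, C < z → ∫ x, x ^ 0 * (z - x)⁻¹ ∂ρ = ∫ x, x ^ 0 * (z - x)⁻¹ ∂ρ' := by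
        simpa using h
      exact ⟨h0, hstep 0 h0⟩
    | succ k ih =>
      have h1 : ∀ z, C < z →
          ∫ x, x ^ (k + 1) * (z - x)⁻¹ ∂ρ = ∫ x, x ^ (k + 1) * (z - x)⁻¹ ∂ρ' := by
        intro z hz
        rw [hrec k z hz ρ hρ, hrec k z hz ρ' hρ', ih.1 z hz, ih.2]
      exact ⟨h1, hstep _ h1⟩
  have hpoly : ∀ p : Polynomial ℝ, ∫ x, p.eval x ∂ρ = ∫ x, p.eval x ∂ρ' := by
    intro p
    simp_rw [Polynomial.eval_eq_sum_range]
    rw [integral_finsetSum _ fun i _ => (hpowint i ρ hρ).const_mul _,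
      integral_finsetSum _ fun i _ => (hpowint i ρ' hρ').const_mul _]
    refine Finset.sum_congr rfl fun i _ => ?_
    rw [integral_const_mul, integral_const_mul, (hmom i).2]
  have hpolyint : ∀ (p : Polynomial ℝ) (τ : Measure ℝ) [IsProbabilityMeasure τ],
      (∀ᵐ x ∂τ, x ∈ Set.Icc (-C) C) → Integrable (fun x => p.eval x) τ := by
    intro p τ _ hτ
    simp_rw [Polynomial.eval_eq_sum_range]
    exact integrable_finsetSum _ fun i _ => (hpowint i τ hτ).const_mul _
  refine ext_of_forall_integral_eq_of_IsFiniteMeasure fun f => ?_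
  refine eq_of_forall_dist_le fun ε hε => ?_
  obtain ⟨p, hp⟩ := exists_polynomial_near_of_continuousOn (-C) C f f.continuous.continuousOn
    (ε / 2) (by positivity)
  have hclose : ∀ (τ : Measure ℝ) [IsProbabilityMeasure τ],
      (∀ᵐ x ∂τ, x ∈ Set.Icc (-C) C) → dist (∫ x, f x ∂τ) (∫ x, p.eval x ∂τ) ≤ ε / 2 := by
    intro τ _ hτ
    rw [dist_eq_norm, ← integral_sub (f.integrable τ) (hpolyint p τ hτ)]
    refine (norm_integral_le_of_norm_le_const (C := ε / 2) ?_).trans (by simp)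
    filter_upwards [hτ] with x hx
    rw [norm_sub_rev]
    exact (hp x hx).le
  have h1 := hclose ρ hρ
  have h2 := hclose ρ' hρ'
  rw [← hpoly p, dist_comm] at h2
  linarith [dist_triangle (∫ x, f x ∂ρ) (∫ x, p.eval x ∂ρ) (∫ x, f x ∂ρ')]

/-- Passage from logarithmic potentials to Stieltjes transforms, on the real line. -/
theorem real_stieltjes_of_log {ρ ν : Measure ℝ} [IsProbabilityMeasure ρ]
    [IsProbabilityMeasure ν] {a l r σ : ℝ} (ha : 0 < a) (hσ : σ ≠ 0)
    (hρ : ∀ᵐ x ∂ρ, x ∈ Set.Icc l r) (hν : ∀ᵐ x ∂ν, x ∈ Set.Icc l r)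
    (hlog : ∀ z, (∀ x ∈ Set.Icc l r, 0 < σ * (z - x)) →
      ∫ x, Real.log (σ * (z - x)) ∂ρ = a⁻¹ * Real.log (∫ x, (σ * (z - x)) ^ a ∂ν))
    {z : ℝ} (hz : ∀ x ∈ Set.Icc l r, 0 < σ * (z - x)) :
    ∫ x, (z - x)⁻¹ ∂ρ =
      σ * (∫ x, (σ * (z - x)) ^ (a - 1) ∂ν) / ∫ x, (σ * (z - x)) ^ a ∂ν := by
  set U : Set ℝ := {y | 0 < σ * y} with hUdef
  have hU : IsOpen U := isOpen_lt continuous_const (by fun_prop)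
  have hUne : ∀ y ∈ U, y ≠ 0 := by
    rintro y (hy : 0 < σ * y) rfl
    simp at hy
  have hd1 := hasDerivAt_integral_comp_sub (𝕜 := ℝ) isCompact_Icc hρ hU
    (g := fun y => Real.log (σ * y)) (g' := fun y => y⁻¹)
    (fun y hy => by
      have := ((hasDerivAt_id y).const_mul σ).log (ne_of_gt hy)
      refine this.congr_deriv ?_
      have := hUne y hy
      simp only [id]
      field_simp)
    (fun y hy => (continuousAt_inv₀ (hUne y hy)).continuousWithinAt)
    (by fun_prop) (by fun_prop) (z := z) hz
  have hd2 := hasDerivAt_integral_comp_sub (𝕜 := ℝ) isCompact_Icc hν hU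
    (g := fun y => (σ * y) ^ a) (g' := fun y => σ * a * (σ * y) ^ (a - 1))
    (fun y hy => by
      have := ((hasDerivAt_id y).const_mul σ).rpow_const (p := a) (Or.inl (ne_of_gt hy))
      refine this.congr_deriv ?_
      simp only [id]
      ring)
    (fun y hy => (continuousAt_const.mul ((continuousAt_const.mul continuousAt_id).rpow_const
      (Or.inl (ne_of_gt hy)))).continuousWithinAt)
    (by fun_prop) (by fun_prop) (z := z) hz
  simp only [RCLike.ofReal_real_eq_id, id] at hd1 hd2
  have hJpos : 0 < ∫ x, (σ * (z - x)) ^ a ∂ν := by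
    refine integral_pos_of_ae_pos (integrable_of_ae_mem_compact isCompact_Icc hν
      (Measurable.aestronglyMeasurable (by fun_prop))
      fun x hx => ?_) (hν.mono fun x hx => Real.rpow_pos_of_pos (hz x hx) a)
    exact ((by fun_prop : Continuous fun x : ℝ => σ * (z - x)).continuousAt.rpow_const
      (Or.inl (hz x hx).ne')).continuousWithinAt
  -- The admissible `z` form a neighbourhood of `z` by compactness, so the potential identity holds
  -- near `z` and may be differentiated.
  have hev : ∀ᶠ w in 𝓝 z, ∀ x ∈ Set.Icc l r, 0 < σ * (w - x) := by
    refine isCompact_Icc.eventually_forall_of_forall_eventually fun x hx => ?_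
    exact (by fun_prop : Continuous fun q : ℝ × ℝ => σ * (q.1 - q.2)).continuousAt.eventually
      (eventually_gt_nhds (hz x hx))
  have hd3 := (hd2.log hJpos.ne').const_mul a⁻¹
  have hd4 := hd3.congr_of_eventuallyEq (hev.mono fun w hw => hlog w hw)
  rw [hd1.unique hd4, integral_const_mul]
  field_simp

/-! ### Limit law of the weighted means for a fixed diagonal. -/

/-- Along some scale, the Laplace transform of the square of a variable with law `μ` is
asymptotically that of a positive `a`-stable domain of attraction. -/
def HasScale (μ : Measure ℝ) (a : ℝ) : Prop :=
  ∃ s : ℕ → ℝ, (∀ᶠ n in atTop, 0 < s n) ∧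
    ∀ u, 0 < u → Tendsto (fun n : ℕ => n * (1 - sqLaplace μ (s n * u))) atTop (𝓝 (u ^ a))

/-- The mean of `d` with weights proportional to the squares of `x`, with value `l` when all
the weights vanish. -/
def weightedMean {n : ℕ} (l : ℝ) (d x : Fin n → ℝ) : ℝ :=
  l + (∑ i, (d i - l) * x i ^ 2) / ∑ i, x i ^ 2

theorem measurable_weightedMean {n : ℕ} (l : ℝ) (d : Fin n → ℝ) :
    Measurable (weightedMean l d) := by
  unfold weightedMean
  fun_prop

theorem weightedMean_of_sum_eq_zero {n : ℕ} (l : ℝ) (d : Fin n → ℝ) {x : Fin n → ℝ}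
    (hx : ∑ i, x i ^ 2 = 0) : weightedMean l d x = l := by
  simp [weightedMean, hx]

theorem weightedMean_of_sum_ne_zero {n : ℕ} (l : ℝ) (d : Fin n → ℝ) {x : Fin n → ℝ}
    (hx : ∑ i, x i ^ 2 ≠ 0) :
    weightedMean l d x = (∑ i, d i * x i ^ 2) / ∑ i, x i ^ 2 := by
  simp only [weightedMean, sub_mul, Finset.sum_sub_distrib, ← Finset.mul_sum]
  field_simp
  ring

theorem weightedMean_mem {n : ℕ} {l r : ℝ} (hlr : l ≤ r) {d : Fin n → ℝ}
    (hd : ∀ i, d i ∈ Set.Icc l r) (x : Fin n → ℝ) : weightedMean l d x ∈ Set.Icc l r := by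
  by_cases hx : ∑ i, x i ^ 2 = 0
  · rw [weightedMean_of_sum_eq_zero l d hx]; exact ⟨le_rfl, hlr⟩
  · have hpos : 0 < ∑ i, x i ^ 2 :=
      lt_of_le_of_ne (Finset.sum_nonneg fun i _ => sq_nonneg _) (Ne.symm hx)
    have := sum_mul_sq_mem hd x
    rw [weightedMean_of_sum_ne_zero l d hx]
    exact ⟨by rw [le_div_iff₀ hpos]; exact this.1, by rw [div_le_iff₀ hpos]; exact this.2⟩

section

variable {μ : Measure ℝ} [IsProbabilityMeasure μ] {a : ℝ}

theorem measurableSet_sum_sq_eq_zero (n : ℕ) :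
    MeasurableSet {x : Fin n → ℝ | ∑ i, x i ^ 2 = 0} :=
  measurableSet_eq_fun (by fun_prop) measurable_const

/-- The probability is `μ{0}^n`, and `μ{0} = 1` would force the scaled limit at `u = 1` to be `0`
instead of `1`. Hence the conventions chosen for the null vector do not affect limits. -/
theorem HasScale.tendsto_measure_sum_sq_eq_zero (h : HasScale μ a) :
    Tendsto (fun n : ℕ => (Measure.pi fun _ : Fin n => μ).real {x | ∑ i, x i ^ 2 = 0}) atTop
      (𝓝 0) := by
  obtain ⟨s, -, hs⟩ := h
  have h1 : μ.real {0} < 1 := by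
    refine lt_of_le_of_ne measureReal_le_one fun h => ?_
    have hae : ∀ᵐ x ∂μ, x = 0 := by
      have : μ {0} = 1 := by
        rw [measureReal_def] at h
        rw [← ENNReal.ofReal_toReal (measure_ne_top μ {0}), h, ENNReal.ofReal_one]
      have := (prob_compl_eq_zero_iff (measurableSet_singleton (0 : ℝ))).2 this
      exact this
    have hφ : ∀ t, sqLaplace μ t = 1 := by
      intro t
      have : ∫ x, Real.exp (-(t * x ^ 2)) ∂μ = ∫ _x, (1 : ℝ) ∂μ :=
        integral_congr_ae (hae.mono fun x hx => by simp [hx])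
      simpa [sqLaplace] using this
    have := hs 1 one_pos
    simp only [hφ, sub_self, mul_zero, Real.one_rpow] at this
    exact zero_ne_one (tendsto_nhds_unique tendsto_const_nhds this)
  refine (tendsto_pow_atTop_nhds_zero_of_lt_one measureReal_nonneg h1).congr fun n => ?_
  have e : {x : Fin n → ℝ | ∑ i, x i ^ 2 = 0} = {fun _ => 0} := by
    ext x
    simp only [Set.mem_ofPred_eq, Set.mem_singleton_iff]
    rw [Finset.sum_eq_zero_iff_of_nonneg fun i _ => sq_nonneg _]
    simp [funext_iff]
  simp only [e, measureReal_def]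
  rw [Measure.pi_singleton]
  simp

variable {ν : Measure ℝ} [IsProbabilityMeasure ν] {l r : ℝ} {d : (n : ℕ) → Fin n → ℝ}

theorem ae_mem_Icc_of_empirical (hlr : l ≤ r) (hd : ∀ᶠ n in atTop, ∀ i, d n i ∈ Set.Icc l r)
    (hν : ∀ f : ℝ →ᵇ ℝ, Tendsto (fun n : ℕ => (n : ℝ)⁻¹ * ∑ i, f (d n i)) atTop
      (𝓝 (∫ x, f x ∂ν))) : ∀ᵐ x ∂ν, x ∈ Set.Icc l r := by
  refine ae_mem_Icc_of_tendsto hlr (Φ := fun (n : ℕ) f => (n : ℝ)⁻¹ * ∑ i, f (d n i)) (F := atTop)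
    (fun f hf => ?_) hν
  filter_upwards [hd] with n hn
  rw [Finset.sum_eq_zero fun i _ => hf _ (hn i), mul_zero]

/-- Away from the null vector, `σ (z - weightedMean)` is the ratio of weighted sums of squares with
weights `σ (z - dᵢ)`, so this is the limit of expected logarithms read as a logarithmic potential.
-/
theorem HasScale.tendsto_integral_log (h : HasScale μ a) (ha : 0 < a) (hlr : l ≤ r)
    (hd : ∀ᶠ n in atTop, ∀ i, d n i ∈ Set.Icc l r)
    (hν : ∀ f : ℝ →ᵇ ℝ, Tendsto (fun n : ℕ => (n : ℝ)⁻¹ * ∑ i, f (d n i)) atTop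
      (𝓝 (∫ x, f x ∂ν))) {σ z : ℝ} (hz : ∀ x ∈ Set.Icc l r, 0 < σ * (z - x)) :
    Tendsto (fun n : ℕ => ∫ x, Real.log (σ * (z - weightedMean l (d n) x))
      ∂(Measure.pi fun _ : Fin n => μ)) atTop
      (𝓝 (a⁻¹ * Real.log (∫ x, (σ * (z - x)) ^ a ∂ν))) := by
  have hS := h.tendsto_measure_sum_sq_eq_zero
  obtain ⟨s, hs₀, hs⟩ := h
  have hl := hz l ⟨le_rfl, hlr⟩
  have hr := hz r ⟨hlr, le_rfl⟩
  set e := min 1 (min (σ * (z - l)) (σ * (z - r))) with he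
  set k := max 1 (max (σ * (z - l)) (σ * (z - r))) with hk
  have he0 : 0 < e := lt_min one_pos (lt_min hl hr)
  have hbd : ∀ x ∈ Set.Icc l r, σ * (z - x) ∈ Set.Icc e k := by
    intro x hx
    rcases le_total 0 σ with hσ | hσ
    · exact ⟨((min_le_right _ _).trans (min_le_right _ _)).trans (by gcongr; exact hx.2),
        le_trans (by gcongr; exact hx.1) ((le_max_left _ _).trans (le_max_right _ _))⟩
    · exact ⟨((min_le_right _ _).trans (min_le_left _ _)).trans
          (mul_le_mul_of_nonpos_left (by linarith [hx.1]) hσ),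
        le_trans (mul_le_mul_of_nonpos_left (by linarith [hx.2]) hσ)
          ((le_max_right _ _).trans (le_max_right _ _))⟩
  have hc : ∀ᶠ n in atTop, ∀ i, σ * (z - d n i) ∈ Set.Icc e k :=
    hd.mono fun n hn i => hbd _ (hn i)
  have havg : Tendsto (fun n : ℕ => (n : ℝ)⁻¹ * ∑ i, (σ * (z - d n i)) ^ a) atTop
      (𝓝 (∫ x, (σ * (z - x)) ^ a ∂ν)) := by
    obtain ⟨f, hf⟩ := exists_boundedContinuous_eqOn hlr (φ := fun x => (σ * (z - x)) ^ a)
      ((by fun_prop : Continuous fun x : ℝ => σ * (z - x)).continuousOn.rpow_const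
        fun x _ => Or.inr ha.le)
    have := hν f
    rw [integral_congr_ae ((ae_mem_Icc_of_empirical hlr hd hν).mono fun x hx => hf x hx)] at this
    refine this.congr' ?_
    filter_upwards [hd] with n hn
    rw [Finset.sum_congr rfl fun i _ => hf _ (hn i)]
  have hmain := tendsto_integral_log_ratio ha hs₀ hs he0 (min_le_left _ _) (le_max_left _ _) hc
    havg
  -- On the null event the mean is `l` by convention, whereas the logarithm of the ratio is `0`. The
  -- correction is this constant times a vanishing probability.
  have hzero := hS.mul_const (Real.log (σ * (z - l)))
  rw [zero_mul] at hzero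
  have hsum := hmain.add hzero
  rw [add_zero] at hsum
  refine hsum.congr' ?_
  filter_upwards [hc] with n hn
  rw [← smul_eq_mul (a := Measure.real _ _), ← integral_indicator_const _
    (measurableSet_sum_sq_eq_zero n), ← integral_add
    (integrable_log_ratio he0 (min_le_left _ _) (le_max_left _ _) hn)
    ((integrable_const _).indicator (measurableSet_sum_sq_eq_zero n))]
  refine integral_congr_ae (Eventually.of_forall fun x => ?_)
  by_cases hx : ∑ i, x i ^ 2 = 0
  · simp [weightedMean_of_sum_eq_zero l _ hx, hx]
  · simp only [weightedMean_of_sum_ne_zero l _ hx, Set.indicator, Set.mem_ofPred_eq, hx, if_false,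
      add_zero]
    congr 1
    simp only [mul_sub, sub_mul, Finset.sum_sub_distrib, mul_assoc, ← Finset.mul_sum]
    field_simp

/-- Existence of the limit law of the weighted means and its Stieltjes transform on the real
line. -/
theorem HasScale.exists_tendsto (h : HasScale μ a) (ha : 0 < a) (hlr : l ≤ r)
    (hd : ∀ᶠ n in atTop, ∀ i, d n i ∈ Set.Icc l r)
    (hν : ∀ f : ℝ →ᵇ ℝ, Tendsto (fun n : ℕ => (n : ℝ)⁻¹ * ∑ i, f (d n i)) atTop
      (𝓝 (∫ x, f x ∂ν))) :
    ∃ ρ : ProbabilityMeasure ℝ, (∀ᵐ x ∂(ρ : Measure ℝ), x ∈ Set.Icc l r) ∧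
      (∀ σ, σ ≠ 0 → ∀ z, (∀ x ∈ Set.Icc l r, 0 < σ * (z - x)) →
        ∫ x, (z - x)⁻¹ ∂(ρ : Measure ℝ) =
          σ * (∫ x, (σ * (z - x)) ^ (a - 1) ∂ν) / ∫ x, (σ * (z - x)) ^ a ∂ν) ∧
      ∀ f : ℝ →ᵇ ℝ, Tendsto (fun n : ℕ => ∫ x, f (weightedMean l (d n) x)
        ∂(Measure.pi fun _ : Fin n => μ)) atTop (𝓝 (∫ x, f x ∂(ρ : Measure ℝ))) := by
  have hνI := ae_mem_Icc_of_empirical hlr hd hν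
  let law : ℕ → ProbabilityMeasure ℝ := fun n =>
    ⟨(Measure.pi fun _ : Fin n => μ).map (weightedMean l (d n)),
      Measure.isProbabilityMeasure_map (measurable_weightedMean l (d n)).aemeasurable⟩
  have hlaw : ∀ n (f : ℝ → ℝ), StronglyMeasurable f → ∫ x, f x ∂(law n : Measure ℝ) =
      ∫ x, f (weightedMean l (d n) x) ∂(Measure.pi fun _ : Fin n => μ) := fun n f hf =>
    integral_map (measurable_weightedMean l (d n)).aemeasurable hf.aestronglyMeasurable
  -- Laws carried by `[l, r]`; the index `_n` is a dummy that fits the tightness criterion for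
  -- compactness.
  set K : Set (ProbabilityMeasure ℝ) := {τ | ∀ _n : ℕ, τ (Set.Icc l r)ᶜ ≤ 0} with hKdef
  have hK : IsCompact K := isCompact_setOfPred_probabilityMeasure_mass_eq_compl_isCompact_le
    tendsto_const_nhds (fun _ => isCompact_Icc) (Or.inr monotone_const)
  have hKae : ∀ τ ∈ K, ∀ᵐ x ∂(τ : Measure ℝ), x ∈ Set.Icc l r := by
    intro τ hτ
    have h0 : τ (Set.Icc l r)ᶜ = 0 := nonpos_iff_eq_zero.1 (hτ 0)
    rw [ProbabilityMeasure.null_iff_toMeasure_null] at h0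
    exact h0
  have hlawK : ∀ᶠ n in atTop, law n ∈ K := by
    filter_upwards [hd] with n hn _
    refine le_of_eq ?_
    rw [ProbabilityMeasure.null_iff_toMeasure_null]
    change ((Measure.pi fun _ : Fin n => μ).map (weightedMean l (d n))) (Set.Icc l r)ᶜ = 0
    rw [Measure.map_apply (measurable_weightedMean l (d n)) measurableSet_Icc.compl]
    have : weightedMean l (d n) ⁻¹' (Set.Icc l r)ᶜ = ∅ := by
      ext x; simpa using weightedMean_mem hlr hn x
    rw [this, measure_empty]
  -- Every cluster point has the same logarithmic potential, hence the same Stieltjes transform.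
  -- With uniqueness and compactness this upgrades clustering to convergence.
  have hform : ∀ τ ∈ K, MapClusterPt τ atTop law → ∀ σ, σ ≠ 0 → ∀ z,
      (∀ x ∈ Set.Icc l r, 0 < σ * (z - x)) → ∫ x, (z - x)⁻¹ ∂(τ : Measure ℝ) =
          σ * (∫ x, (σ * (z - x)) ^ (a - 1) ∂ν) / ∫ x, (σ * (z - x)) ^ a ∂ν := by
    intro τ hτK hτ σ hσ z hz
    refine real_stieltjes_of_log ha hσ (hKae τ hτK) hνI (fun z hz => ?_) hz
    obtain ⟨f, hf⟩ := exists_boundedContinuous_eqOn hlr (φ := fun x => Real.log (σ * (z - x)))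
      ((by fun_prop : Continuous fun x : ℝ => σ * (z - x)).continuousOn.log
        fun x hx => (hz x hx).ne')
    have h1 : MapClusterPt (∫ x, f x ∂(τ : Measure ℝ)) atTop
        ((fun τ : ProbabilityMeasure ℝ => ∫ x, f x ∂(τ : Measure ℝ)) ∘ law) :=
      hτ.continuousAt_comp
        (ProbabilityMeasure.continuous_integral_boundedContinuousFunction f).continuousAt
    have h2 : Tendsto ((fun τ : ProbabilityMeasure ℝ => ∫ x, f x ∂(τ : Measure ℝ)) ∘ law) atTop
        (𝓝 (a⁻¹ * Real.log (∫ x, (σ * (z - x)) ^ a ∂ν))) := by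
      refine (h.tendsto_integral_log ha hlr hd hν hz).congr' ?_
      filter_upwards [hd] with n hn
      simp only [Function.comp]
      rw [hlaw n f f.continuous.stronglyMeasurable]
      refine integral_congr_ae (Eventually.of_forall fun x => ?_)
      exact (hf _ (weightedMean_mem hlr hn x)).symm
    rw [← integral_congr_ae ((hKae τ hτK).mono fun x hx => hf x hx)]
    have h3 := h1.clusterPt.mono h2
    exact (t2_iff_nhds.1 inferInstance h3 : _)
  obtain ⟨ρ, hρK, hρ⟩ := hK.exists_mapClusterPt (f := atTop) (u := law)
    (le_principal_iff.2 hlawK)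
  refine ⟨ρ, hKae ρ hρK, hform ρ hρK hρ, fun f => ?_⟩
  have huniq : ∀ τ ∈ K, MapClusterPt τ atTop law → τ = ρ := by
    intro τ hτK hτ
    refine Subtype.ext (?_ : (τ : Measure ℝ) = (ρ : Measure ℝ))
    set C := max |l| |r| + 1
    have hsub : Set.Icc l r ⊆ Set.Icc (-C) C := by
      refine Set.Icc_subset_Icc ?_ ?_
      · have := neg_abs_le l
        have := le_max_left |l| |r|
        simp only [C]; linarith
      · have := le_abs_self r
        have := le_max_right |l| |r|
        simp only [C]; linarith
    refine eq_of_real_stieltjes_eq (C := C) (by positivity)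
      ((hKae τ hτK).mono fun x hx => hsub hx) ((hKae ρ hρK).mono fun x hx => hsub hx) fun z hz => ?_
    have hz' : ∀ x ∈ Set.Icc l r, 0 < 1 * (z - x) := fun x hx => by
      have := (hsub hx).2
      linarith
    exact (hform τ hτK hτ 1 one_ne_zero z hz').trans (hform ρ hρK hρ 1 one_ne_zero z hz').symm
  have hlim := hK.tendsto_nhds_of_unique_mapClusterPt hlawK huniq
  refine (ProbabilityMeasure.tendsto_iff_forall_integral_tendsto.1 hlim f).congr fun n => ?_
  exact hlaw n f f.continuous.stronglyMeasurable

/-- Identification of the limit law of the weighted means by its Stieltjes transform near `+∞`. -/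
theorem HasScale.tendsto_weightedMean (h : HasScale μ a) (ha : 0 < a) (hlr : l ≤ r)
    (hd : ∀ᶠ n in atTop, ∀ i, d n i ∈ Set.Icc l r)
    (hν : ∀ f : ℝ →ᵇ ℝ, Tendsto (fun n : ℕ => (n : ℝ)⁻¹ * ∑ i, f (d n i)) atTop
      (𝓝 (∫ x, f x ∂ν))) {ρ : Measure ℝ} [IsProbabilityMeasure ρ] {C : ℝ}
    (hρI : ∀ᵐ x ∂ρ, x ∈ Set.Icc (-C) C)
    (hρ : ∀ z, C < z → ∫ x, (z - x)⁻¹ ∂ρ =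
      (∫ x, (z - x) ^ (a - 1) ∂ν) / ∫ x, (z - x) ^ a ∂ν) (f : ℝ →ᵇ ℝ) :
    Tendsto (fun n : ℕ => ∫ x, f (weightedMean l (d n) x)
        ∂(Measure.pi fun _ : Fin n => μ)) atTop (𝓝 (∫ x, f x ∂ρ)) := by
  obtain ⟨τ, hτI, hτ, hlim⟩ := h.exists_tendsto ha hlr hd hν
  -- One interval carrying both `ρ` and the limit law, so the two transforms need only be compared
  -- beyond it.
  set C' := max C (max |l| |r|) + 1
  have hC : C < C' := by
    have := le_max_left C (max |l| |r|)
    simp only [C']; linarith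
  have hsub : Set.Icc l r ⊆ Set.Icc (-C') C' := by
    have h1 := le_max_right C (max |l| |r|)
    refine Set.Icc_subset_Icc ?_ ?_
    · have := neg_abs_le l
      have := le_max_left |l| |r|
      simp only [C']; linarith
    · have := le_abs_self r
      have := le_max_right |l| |r|
      simp only [C']; linarith
  have hC' : 0 < C' := by
    have : 0 ≤ max C (max |l| |r|) := le_max_of_le_right (le_max_of_le_left (abs_nonneg _))
    simp only [C']; linarith
  have : ρ = (τ : Measure ℝ) := by
    refine eq_of_real_stieltjes_eq hC'
      (hρI.mono fun x hx => ⟨by linarith [hx.1], hx.2.trans hC.le⟩)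
      (hτI.mono fun x hx => hsub hx) fun z hz => ?_
    have hz' : ∀ x ∈ Set.Icc l r, 0 < 1 * (z - x) := fun x hx => by
      have := (hsub hx).2
      linarith
    have h1 := hτ 1 one_ne_zero z hz'
    simp only [one_mul] at h1
    rw [h1, hρ z (hC.trans hz)]
  rw [this]
  exact hlim f

/-- The same limit for the diagonal quadratic forms of the self-normalized vector. -/
theorem HasScale.tendsto_diagForm (h : HasScale μ a) (ha : 0 < a) (hlr : l ≤ r)
    (hd : ∀ᶠ n in atTop, ∀ i, d n i ∈ Set.Icc l r)
    (hν : ∀ f : ℝ →ᵇ ℝ, Tendsto (fun n : ℕ => (n : ℝ)⁻¹ * ∑ i, f (d n i)) atTop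
      (𝓝 (∫ x, f x ∂ν))) {ρ : Measure ℝ} [IsProbabilityMeasure ρ] {C : ℝ}
    (hρI : ∀ᵐ x ∂ρ, x ∈ Set.Icc (-C) C)
    (hρ : ∀ z, C < z → ∫ x, (z - x)⁻¹ ∂ρ =
      (∫ x, (z - x) ^ (a - 1) ∂ν) / ∫ x, (z - x) ^ a ∂ν) (f : ℝ →ᵇ ℝ) :
    Tendsto (fun n : ℕ => ∫ x, f (∑ i, d n i * (x i / √(∑ j, x j ^ 2)) ^ 2)
        ∂(Measure.pi fun _ : Fin n => μ)) atTop (𝓝 (∫ x, f x ∂ρ)) := by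
  have hmain := h.tendsto_weightedMean ha hlr hd hν hρI hρ f
  -- At the null vector the diagonal form is `0`, while `weightedMean` is `l`.
  have hz := h.tendsto_measure_sum_sq_eq_zero.mul_const (f 0 - f l)
  rw [zero_mul] at hz
  have hsum := hmain.add hz
  rw [add_zero] at hsum
  refine hsum.congr fun n => ?_
  have hfint : Integrable (fun x => f (weightedMean l (d n) x))
      (Measure.pi fun _ : Fin n => μ) :=
    Integrable.of_bound (f.continuous.measurable.comp
      (measurable_weightedMean l (d n))).aestronglyMeasurable ‖f‖
      (Eventually.of_forall fun x => f.norm_coe_le_norm _)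
  rw [← smul_eq_mul (a := Measure.real _ _), ← integral_indicator_const _
    (measurableSet_sum_sq_eq_zero n), ← integral_add hfint
    ((integrable_const _).indicator (measurableSet_sum_sq_eq_zero n))]
  refine integral_congr_ae (Eventually.of_forall fun x => ?_)
  by_cases hx : ∑ i, x i ^ 2 = 0
  · simp [weightedMean_of_sum_eq_zero l _ hx, hx]
  · simp only [weightedMean_of_sum_ne_zero l _ hx, Set.indicator, Set.mem_ofPred_eq, hx, if_false,
      add_zero]
    congr 1
    rw [Finset.sum_div]
    refine Finset.sum_congr rfl fun i _ => ?_
    rw [div_pow, Real.sq_sqrt (Finset.sum_nonneg fun i _ => sq_nonneg _), mul_div_assoc]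

end

/-! ### Extension of the Stieltjes formula to complex arguments. -/

theorem resolvent_real_complex (z : ℂ) (x : ℝ) : resolvent z x = ((x : ℂ) - z)⁻¹ := by
  simp [resolvent]

theorem continuousOn_cpow_sub {K : Set ℝ} {z : ℂ} (hz : ∀ x ∈ K, z - (x : ℂ) ∈ Complex.slitPlane)
    (p : ℂ) : ContinuousOn (fun x : ℝ => (z - (x : ℂ)) ^ p) K := fun x hx =>
  ((by fun_prop : Continuous fun x : ℝ => z - (x : ℂ)).continuousAt.cpow continuousAt_const
    (hz x hx)).continuousWithinAt

theorem integrable_cpow_sub {ν : Measure ℝ} [IsFiniteMeasure ν] {K : Set ℝ} (hK : IsCompact K)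
    (hν : ∀ᵐ x ∂ν, x ∈ K) {z : ℂ} (hz : ∀ x ∈ K, z - (x : ℂ) ∈ Complex.slitPlane) (p : ℂ) :
    Integrable (fun x : ℝ => (z - (x : ℂ)) ^ p) ν :=
  integrable_of_ae_mem_compact hK hν (Measurable.aestronglyMeasurable (by fun_prop))
    (continuousOn_cpow_sub hz p)

theorem differentiableAt_integral_cpow_sub {ν : Measure ℝ} [IsFiniteMeasure ν] {K : Set ℝ}
    (hK : IsCompact K) (hν : ∀ᵐ x ∂ν, x ∈ K) {z : ℂ}
    (hz : ∀ x ∈ K, z - (x : ℂ) ∈ Complex.slitPlane) (p : ℂ) :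
    DifferentiableAt ℂ (fun w : ℂ => ∫ x : ℝ, (w - (x : ℂ)) ^ p ∂ν) z :=
  (hasDerivAt_integral_comp_sub (𝕜 := ℂ) hK hν Complex.isOpen_slitPlane
    (g := fun y => y ^ p) (g' := fun y => p * y ^ (p - 1))
    (fun y hy => (Complex.hasStrictDerivAt_cpow_const hy).hasDerivAt)
    (fun y hy => (continuousAt_const.mul
      (continuousAt_id.cpow continuousAt_const hy)).continuousWithinAt)
    (by fun_prop) (by fun_prop) hz).differentiableAt

/-- For `0 < a < 1` the angle `a * arg w` stays in `(0, π)`, so the principal power preserves the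
upper half-plane. -/
theorem cpow_im_pos {w : ℂ} {a : ℝ} (ha₀ : 0 < a) (ha₁ : a < 1) (hw : 0 < w.im) :
    0 < (w ^ (a : ℂ)).im := by
  have hw0 : w ≠ 0 := fun h => by simp [h] at hw
  rw [Complex.cpow_ofReal_im]
  have h1 : 0 < w.arg := lt_of_le_of_ne (Complex.arg_nonneg_iff.2 hw.le) fun h =>
    hw.ne' (Complex.arg_eq_zero_iff.1 h.symm).2
  have h2 : w.arg ≤ Real.pi := Complex.arg_le_pi w
  exact mul_pos (Real.rpow_pos_of_pos (norm_pos_iff.2 hw0) a)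
    (Real.sin_pos_of_pos_of_lt_pi (by positivity) (by nlinarith))

theorem cpow_im_neg {w : ℂ} {a : ℝ} (ha₀ : 0 < a) (ha₁ : a < 1) (hw : w.im < 0) :
    (w ^ (a : ℂ)).im < 0 := by
  have hw0 : w ≠ 0 := fun h => by simp [h] at hw
  rw [Complex.cpow_ofReal_im]
  have h1 : w.arg < 0 := Complex.arg_neg_iff.2 hw
  have h2 : -Real.pi < w.arg := Complex.neg_pi_lt_arg w
  exact mul_neg_of_pos_of_neg (Real.rpow_pos_of_pos (norm_pos_iff.2 hw0) a)
    (Real.sin_neg_of_neg_of_neg_pi_lt (by nlinarith) (by nlinarith))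

section

variable {ν : Measure ℝ} {l r a : ℝ}

theorem ofReal_integral_rpow_sub (hν : ∀ᵐ x ∂ν, x ∈ Set.Icc l r) {t : ℝ} (ht : r < t) (p : ℝ) :
    ∫ x : ℝ, ((t : ℂ) - (x : ℂ)) ^ (p : ℂ) ∂ν = ((∫ x, (t - x) ^ p ∂ν : ℝ) : ℂ) := by
  rw [← integral_complex_ofReal]
  refine integral_congr_ae (hν.mono fun x hx => ?_)
  simp only
  rw [Complex.ofReal_cpow (by linarith [hx.2]), Complex.ofReal_sub]

variable [IsProbabilityMeasure ν]

theorem integral_rpow_sub_pos (hν : ∀ᵐ x ∂ν, x ∈ Set.Icc l r) {σ t : ℝ}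
    (ht : ∀ x ∈ Set.Icc l r, 0 < σ * (t - x)) (p : ℝ) : 0 < ∫ x, (σ * (t - x)) ^ p ∂ν := by
  refine integral_pos_of_ae_pos (integrable_of_ae_mem_compact isCompact_Icc hν
    (Measurable.aestronglyMeasurable (by fun_prop)) fun x hx => ?_)
    (hν.mono fun x hx => Real.rpow_pos_of_pos (ht x hx) p)
  exact ((by fun_prop : Continuous fun x : ℝ => σ * (t - x)).continuousAt.rpow_const
    (Or.inl (ht x hx).ne')).continuousWithinAt

/-- Off the real axis the imaginary part of the integrand has a strict constant sign; on the axis to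
the right of `r` the integrand is positive. The denominator of the formula therefore never vanishes
on the slit domain. -/
theorem integral_cpow_sub_ne_zero (ha₀ : 0 < a) (ha₁ : a < 1) (hν : ∀ᵐ x ∂ν, x ∈ Set.Icc l r)
    {z : ℂ} (hz : z - (r : ℂ) ∈ Complex.slitPlane)
    (hz' : ∀ x ∈ Set.Icc l r, z - (x : ℂ) ∈ Complex.slitPlane) :
    ∫ x : ℝ, (z - (x : ℂ)) ^ (a : ℂ) ∂ν ≠ 0 := by
  have hint := integrable_cpow_sub isCompact_Icc hν hz' (a : ℂ)
  have him : (∫ x : ℝ, (z - (x : ℂ)) ^ (a : ℂ) ∂ν).im =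
      ∫ x : ℝ, ((z - (x : ℂ)) ^ (a : ℂ)).im ∂ν := (integral_im hint).symm
  have hintim : Integrable (fun x : ℝ => ((z - (x : ℂ)) ^ (a : ℂ)).im) ν := hint.im
  rcases lt_trichotomy z.im 0 with h | h | h
  · have : 0 < ∫ x : ℝ, -((z - (x : ℂ)) ^ (a : ℂ)).im ∂ν :=
      integral_pos_of_ae_pos hintim.neg (Eventually.of_forall fun x =>
        neg_pos.2 (cpow_im_neg ha₀ ha₁ (by simpa using h)))
    rw [integral_neg, ← him] at this
    intro h0
    simp [h0] at this
  · have hzr : z = (z.re : ℂ) := by apply Complex.ext <;> simp [h]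
    have ht : r < z.re := by
      rw [hzr, Complex.mem_slitPlane_iff] at hz
      simpa using hz
    rw [hzr, ofReal_integral_rpow_sub hν ht]
    have := integral_rpow_sub_pos hν (σ := 1) (t := z.re)
      (fun x hx => by linarith [hx.2]) a
    simp only [one_mul] at this
    exact Complex.ofReal_ne_zero.2 this.ne'
  · have : 0 < ∫ x : ℝ, ((z - (x : ℂ)) ^ (a : ℂ)).im ∂ν :=
      integral_pos_of_ae_pos hintim (Eventually.of_forall fun x =>
        cpow_im_pos ha₀ ha₁ (by simpa using h))
    rw [← him] at this
    intro h0
    simp [h0] at this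

theorem sub_mem_slitPlane {z : ℂ} (hz : z - (r : ℂ) ∈ Complex.slitPlane) :
    ∀ x ∈ Set.Icc l r, z - (x : ℂ) ∈ Complex.slitPlane := by
  intro x hx
  rw [Complex.mem_slitPlane_iff] at hz ⊢
  simp only [Complex.sub_re, Complex.ofReal_re, Complex.sub_im, Complex.ofReal_im, sub_zero] at hz ⊢
  exact hz.imp_left fun h => by linarith [hx.2]

variable {ρ : Measure ℝ} [IsProbabilityMeasure ρ]

theorem resolventTransform_ofReal (ρ : Measure ℝ) (t : ℝ) :
    resolventTransform ρ (t : ℂ) = -((∫ x, (t - x)⁻¹ ∂ρ : ℝ) : ℂ) := by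
  rw [resolventTransform_apply, ← integral_complex_ofReal, ← integral_neg]
  refine integral_congr_ae (Eventually.of_forall fun x => ?_)
  simp only [resolvent_real_complex, Complex.ofReal_inv, Complex.ofReal_sub]
  rw [← inv_neg, neg_sub]

/-- The Stieltjes formula off the interval follows from its real version. -/
theorem resolventTransform_eq_of_real (ha₀ : 0 < a) (ha₁ : a < 1)
    (hν : ∀ᵐ x ∂ν, x ∈ Set.Icc l r) (hρ : ∀ᵐ x ∂ρ, x ∈ Set.Icc l r)
    (h : ∀ σ, σ ≠ 0 → ∀ z, (∀ x ∈ Set.Icc l r, 0 < σ * (z - x)) →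
        ∫ x, (z - x)⁻¹ ∂ρ =
          σ * (∫ x, (σ * (z - x)) ^ (a - 1) ∂ν) / ∫ x, (σ * (z - x)) ^ a ∂ν)
    {z : ℂ} (hz : z ∉ Complex.ofReal '' Set.Icc l r) :
    resolventTransform ρ z =
      -((∫ x : ℝ, (z - (x : ℂ)) ^ (((a - 1 : ℝ)) : ℂ) ∂ν) /
        (∫ x : ℝ, (z - (x : ℂ)) ^ (a : ℂ) ∂ν)) := by
  have hsupp : ρ.support ⊆ Set.Icc l r := Measure.support_subset_of_isClosed isClosed_Icc hρ
  by_cases hzs : z - (r : ℂ) ∈ Complex.slitPlane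
  · set U : Set ℂ := {w | w - (r : ℂ) ∈ Complex.slitPlane} with hUdef
    have hUo : IsOpen U := Complex.isOpen_slitPlane.preimage (by fun_prop)
    have hUc : IsPreconnected U := by
      have : U = (fun w : ℂ => (r : ℂ) + w) '' Complex.slitPlane := by
        ext w
        constructor
        · intro hw
          exact ⟨w - r, hw, by ring⟩
        · rintro ⟨y, hy, rfl⟩
          simpa [hUdef] using hy
      rw [this]
      exact (StarConvex.isPathConnected Complex.starConvex_one_slitPlane
        Complex.one_mem_slitPlane).isConnected.isPreconnected.image _ (by fun_prop)
    set N : ℂ → ℂ := fun w => ∫ x : ℝ, (w - (x : ℂ)) ^ (((a - 1 : ℝ)) : ℂ) ∂ν with hN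
    set D : ℂ → ℂ := fun w => ∫ x : ℝ, (w - (x : ℂ)) ^ (a : ℂ) ∂ν with hD
    -- Clearing the denominator makes the identity theorem apply on the connected domain `ℂ \ (-∞,
    -- r]`; `D` has to be nonzero only at the final point `z`.
    have hdiff : DifferentiableOn ℂ (fun w => resolventTransform ρ w * D w + N w) U := by
      intro w hw
      have hw' := sub_mem_slitPlane (l := l) hw
      refine DifferentiableAt.differentiableWithinAt (DifferentiableAt.add (DifferentiableAt.mul ?_
        (differentiableAt_integral_cpow_sub isCompact_Icc hν hw' _))
        (differentiableAt_integral_cpow_sub isCompact_Icc hν hw' _))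
      refine (hasDerivAt_resolventTransform w ?_).differentiableAt
      rintro ⟨x, hx, rfl⟩
      have := hw' x (hsupp hx)
      simp [Complex.zero_notMem_slitPlane] at this
    have hreal : ∀ t : ℝ, r < t →
        resolventTransform ρ (t : ℂ) * D (t : ℂ) + N (t : ℂ) = 0 := by
      intro t ht
      have hpos : ∀ x ∈ Set.Icc l r, 0 < 1 * (t - x) := fun x hx => by linarith [hx.2]
      have h1 := h 1 one_ne_zero t hpos
      have h2 := integral_rpow_sub_pos hν hpos a
      simp only [one_mul] at h1 h2
      simp only [hN, hD]
      rw [resolventTransform_ofReal, ofReal_integral_rpow_sub hν ht,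
        ofReal_integral_rpow_sub hν ht, h1]
      have h3 := Complex.ofReal_ne_zero.2 h2.ne'
      rw [Complex.ofReal_div]
      field_simp
      ring
    have hmem : ((r + 1 : ℝ) : ℂ) ∈ U := by
      rw [hUdef, Set.mem_ofPred_eq, Complex.mem_slitPlane_iff]
      left; simp
    have hzero := (hdiff.analyticOnNhd hUo).eqOn_zero_of_preconnected_of_frequently_eq_zero hUc
      hmem (by
        have htend : Tendsto (fun t : ℝ => (t : ℂ)) (𝓝[>] (r + 1)) (𝓝[≠] ((r + 1 : ℝ) : ℂ)) := by
          refine tendsto_nhdsWithin_iff.2 ⟨?_, ?_⟩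
          · exact (Complex.continuous_ofReal.tendsto _).mono_left nhdsWithin_le_nhds
          · filter_upwards [self_mem_nhdsWithin] with t (ht : r + 1 < t)
            exact Complex.ofReal_injective.ne ht.ne'
        refine htend.frequently (Eventually.frequently ?_)
        filter_upwards [self_mem_nhdsWithin] with t (ht : r + 1 < t)
        exact hreal t (by linarith)) hzs
    have hD0 : D z ≠ 0 := integral_cpow_sub_ne_zero ha₀ ha₁ hν hzs (sub_mem_slitPlane hzs)
    have h0 : resolventTransform ρ z * D z + N z = 0 := hzero
    rw [← neg_div, eq_div_iff hD0]
    exact eq_neg_of_add_eq_zero_left h0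
  · rw [Complex.mem_slitPlane_iff] at hzs
    push Not at hzs
    have him : z.im = 0 := by simpa using hzs.2
    have hre : z.re ≤ r := by simpa using hzs.1
    have hzr : z = (z.re : ℂ) := by apply Complex.ext <;> simp [him]
    set t := z.re
    -- What remains is real `z` to the left of the interval. There the bases lie on the branch cut,
    -- so analytic continuation from the right is not available and the real formula with `σ = -1`
    -- is used.
    have htl : t < l := by
      by_contra! hcon
      exact hz ⟨t, ⟨hcon, hre⟩, hzr.symm⟩
    have hpos : ∀ x ∈ Set.Icc l r, 0 < (-1) * (t - x) := fun x hx => by linarith [hx.1]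
    have h1 := h (-1) (by norm_num) t hpos
    have hpow : ∀ p : ℝ, ∫ x : ℝ, (z - (x : ℂ)) ^ (p : ℂ) ∂ν =
        ((∫ x, (-1 * (t - x)) ^ p ∂ν : ℝ) : ℂ) * Complex.exp (Real.pi * Complex.I * p) := by
      intro p
      rw [← integral_complex_ofReal, ← integral_mul_const]
      refine integral_congr_ae (hν.mono fun x hx => ?_)
      have hx' : t - x ≤ 0 := by linarith [hx.1]
      simp only
      rw [hzr, ← Complex.ofReal_sub, Complex.ofReal_cpow_of_nonpos hx', ← Complex.ofReal_neg,
        ← Complex.ofReal_cpow (by linarith), neg_one_mul]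
    have hJ := Complex.ofReal_ne_zero.2 (integral_rpow_sub_pos hν hpos a).ne'
    rw [hpow, hpow, hzr, resolventTransform_ofReal, h1]
    -- On the cut, principal powers carry the phases `e^{iπ(a-1)}` and `e^{iπa}`. Their quotient
    -- `-1` is exactly the factor `σ`.
    have hexp : Complex.exp (Real.pi * Complex.I * ((a - 1 : ℝ) : ℂ)) =
        -Complex.exp (Real.pi * Complex.I * a) := by
      rw [Complex.ofReal_sub, Complex.ofReal_one, mul_sub, mul_one, Complex.exp_sub,
        Complex.exp_pi_mul_I, div_neg, div_one]
    rw [hexp]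
    have hE := Complex.exp_ne_zero (Real.pi * Complex.I * a)
    push_cast at hJ ⊢
    field_simp

end

/-! ### The limit law: support, uniqueness, existence. -/

/-- The closed convex hull of a nonempty bounded set of reals is a compact interval. -/
theorem closure_convexHull_eq_Icc {s : Set ℝ} (hs : s.Nonempty) {l r : ℝ}
    (hsub : s ⊆ Set.Icc l r) :
    ∃ m M, m ≤ M ∧ closure (convexHull ℝ s) = Set.Icc m M := by
  set K := closure (convexHull ℝ s) with hK
  have hKsub : K ⊆ Set.Icc l r :=
    closure_minimal (convexHull_min hsub (convex_Icc l r)) isClosed_Icc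
  have hne : K.Nonempty := hs.mono ((subset_convexHull ℝ s).trans subset_closure)
  have hconn : IsConnected K := ⟨hne, (convex_convexHull ℝ s).closure.isPreconnected⟩
  have heq := eq_Icc_csInf_csSup_of_connected_bdd_closed hconn (bddBelow_Icc.mono hKsub)
    (bddAbove_Icc.mono hKsub) isClosed_closure
  refine ⟨sInf K, sSup K, ?_, heq⟩
  exact csInf_le_csSup hne (bddBelow_Icc.mono hKsub) (bddAbove_Icc.mono hKsub)

section law

variable {ν μ : ProbabilityMeasure ℝ} {α m M : ℝ}

/-- This rests on the support clause of the definition, evaluated at real points outside the hull.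
-/
theorem IsQuadFormLaw.ae_mem (h : IsQuadFormLaw ν α μ)
    (hK : closure (convexHull ℝ (ν : Measure ℝ).support) = Set.Icc m M) :
    ∀ᵐ x ∂(μ : Measure ℝ), x ∈ Set.Icc m M := by
  filter_upwards [Measure.support_mem_ae (μ := (μ : Measure ℝ))] with x hx
  by_contra hcon
  refine (h (x : ℂ) ?_).1 ⟨x, hx, rfl⟩
  rw [hK]
  rintro ⟨y, hy, hyx⟩
  exact hcon (Complex.ofReal_injective hyx ▸ hy)

theorem ae_mem_of_closure_convexHull_support
    (hK : closure (convexHull ℝ (ν : Measure ℝ).support) = Set.Icc m M) :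
    ∀ᵐ x ∂(ν : Measure ℝ), x ∈ Set.Icc m M := by
  filter_upwards [Measure.support_mem_ae (μ := (ν : Measure ℝ))] with x hx
  rw [← hK]
  exact subset_closure (subset_convexHull ℝ _ hx)

theorem IsQuadFormLaw.real_stieltjes (h : IsQuadFormLaw ν α μ)
    (hK : closure (convexHull ℝ (ν : Measure ℝ).support) = Set.Icc m M) {t : ℝ} (ht : M < t) :
    ∫ x, (t - x)⁻¹ ∂(μ : Measure ℝ) =
      (∫ x, (t - x) ^ (α / 2 - 1) ∂(ν : Measure ℝ)) / ∫ x, (t - x) ^ (α / 2) ∂(ν : Measure ℝ) := by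
  have hν := ae_mem_of_closure_convexHull_support hK
  have h1 := (h (t : ℂ) (by
    rw [hK]
    rintro ⟨y, hy, hyt⟩
    have := Complex.ofReal_injective hyt
    linarith [hy.2])).2
  rw [resolventTransform_ofReal, ofReal_integral_rpow_sub hν ht, ofReal_integral_rpow_sub hν ht,
    neg_inj] at h1
  exact_mod_cast h1

theorem IsQuadFormLaw.unique {μ' : ProbabilityMeasure ℝ} (h : IsQuadFormLaw ν α μ)
    (h' : IsQuadFormLaw ν α μ')
    (hK : closure (convexHull ℝ (ν : Measure ℝ).support) = Set.Icc m M) : μ' = μ := by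
  refine Subtype.ext (?_ : (μ' : Measure ℝ) = (μ : Measure ℝ))
  have hC : 0 < max |m| |M| + 1 := by positivity
  have hM : M < max |m| |M| + 1 := by
    have := le_abs_self M
    have := le_max_right |m| |M|
    linarith
  have hsub : Set.Icc m M ⊆ Set.Icc (-(max |m| |M| + 1)) (max |m| |M| + 1) := by
    refine Set.Icc_subset_Icc ?_ hM.le
    have := neg_abs_le m
    have := le_max_left |m| |M|
    linarith
  refine eq_of_real_stieltjes_eq hC ((h'.ae_mem hK).mono fun x hx => hsub hx)
    ((h.ae_mem hK).mono fun x hx => hsub hx) fun z hz => ?_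
  rw [h.real_stieltjes hK (hM.trans hz), h'.real_stieltjes hK (hM.trans hz)]

/-- Existence of the limit law. -/
theorem exists_isQuadFormLaw {τ : Measure ℝ} [IsProbabilityMeasure τ] (hτ : HasScale τ (α / 2))
    (hα₀ : 0 < α) (hα₂ : α < 2) {d : (n : ℕ) → Fin n → ℝ}
    (hν : ∀ f : ℝ →ᵇ ℝ, Tendsto (fun n : ℕ => (n : ℝ)⁻¹ * ∑ i, f (d n i)) atTop
      (𝓝 (∫ x, f x ∂(ν : Measure ℝ)))) (hmM : m ≤ M)
    (hK : closure (convexHull ℝ (ν : Measure ℝ).support) = Set.Icc m M) :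
    ∃ ρ : ProbabilityMeasure ℝ, IsQuadFormLaw ν α ρ := by
  have hνI := ae_mem_of_closure_convexHull_support hK
  -- The points `dᵢ` may leave the hull of the support of `ν`. Projecting them onto `[m, M]` does
  -- not change the weak limit, since `ν` lives there, and gives a law whose formula holds off
  -- exactly this hull rather than off a larger interval.
  set clamp : ℝ → ℝ := fun x => Set.projIcc m M hmM x with hclamp
  have hclampc : Continuous clamp := continuous_subtype_val.comp continuous_projIcc
  have hν' : ∀ f : ℝ →ᵇ ℝ, Tendsto (fun n : ℕ => (n : ℝ)⁻¹ * ∑ i, f (clamp (d n i))) atTop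
      (𝓝 (∫ x, f x ∂(ν : Measure ℝ))) := by
    intro f
    have := hν (f.compContinuous ⟨clamp, hclampc⟩)
    simp only [BoundedContinuousFunction.compContinuous_apply, ContinuousMap.coe_mk] at this
    rwa [integral_congr_ae (g := f) (hνI.mono fun x hx => by
      simp [hclamp, Set.projIcc_of_mem hmM hx])] at this
  obtain ⟨ρ, hρI, hρ, -⟩ := hτ.exists_tendsto (d := fun n i => clamp (d n i))
    (half_pos hα₀) hmM (Eventually.of_forall fun n i => (Set.projIcc m M hmM (d n i)).2) hν'
  refine ⟨ρ, fun z hz => ?_⟩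
  rw [hK] at hz
  refine ⟨fun hzs => hz ?_, resolventTransform_eq_of_real (half_pos hα₀) (by linarith) hνI hρI hρ hz⟩
  exact Set.image_mono (Measure.support_subset_of_isClosed isClosed_Icc hρI) hzs

end law

/-! ### Fourth moments of the normalized vector and the off-diagonal bound. -/

/-- The normalization of a finite real vector (with value `0` at `0`). -/
def unitVec {n : ℕ} (x : Fin n → ℝ) : Fin n → ℝ := fun i => x i / √(∑ j, x j ^ 2)

theorem measurable_unitVec (n : ℕ) : Measurable (unitVec (n := n)) := by
  unfold unitVec
  fun_prop

theorem sum_sq_unitVec_le_one {n : ℕ} (x : Fin n → ℝ) : ∑ i, unitVec x i ^ 2 ≤ 1 := by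
  simp only [unitVec, div_pow, ← Finset.sum_div]
  rw [Real.sq_sqrt (Finset.sum_nonneg fun i _ => sq_nonneg _)]
  exact div_self_le_one _

theorem abs_unitVec_le_one {n : ℕ} (x : Fin n → ℝ) (i : Fin n) : |unitVec x i| ≤ 1 := by
  rw [← sq_le_one_iff_abs_le_one]
  exact (Finset.single_le_sum (f := fun i => unitVec x i ^ 2) (fun i _ => sq_nonneg _)
    (Finset.mem_univ i)).trans (sum_sq_unitVec_le_one x)

section

variable {τ : Measure ℝ} [IsProbabilityMeasure τ] {n : ℕ}

/-- Mixed fourth moments of the normalized vector. -/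
def fourthMoment (τ : Measure ℝ) {n : ℕ} (p q : Fin n × Fin n) : ℝ :=
  ∫ x, unitVec x p.1 * unitVec x p.2 * (unitVec x q.1 * unitVec x q.2)
    ∂(Measure.pi fun _ : Fin n => τ)

theorem integrable_fourth (p q : Fin n × Fin n) :
    Integrable (fun x => unitVec x p.1 * unitVec x p.2 * (unitVec x q.1 * unitVec x q.2))
      (Measure.pi fun _ : Fin n => τ) := by
  have hm : ∀ i, Measurable fun x : Fin n → ℝ => unitVec x i := fun i =>
    (measurable_pi_apply i).comp (measurable_unitVec n)
  refine Integrable.of_bound (C := 1)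
    ((((hm _).mul (hm _)).mul ((hm _).mul (hm _))).aestronglyMeasurable)
    (Eventually.of_forall fun x => ?_)
  simp only [norm_mul, Real.norm_eq_abs]
  have h := abs_unitVec_le_one x
  have h0 : ∀ i, 0 ≤ |unitVec x i| := fun i => abs_nonneg _
  exact mul_le_one₀ (mul_le_one₀ (h _) (h0 _) (h _)) (mul_nonneg (h0 _) (h0 _))
    (mul_le_one₀ (h _) (h0 _) (h _))

/-- Flipping the sign of coordinate `k` preserves the product law and the Euclidean norm, so it acts
on the normalized vector by the same flip. -/
theorem fourthMoment_eq_of_sign (hτ : τ.map (fun x => -x) = τ) (k : Fin n)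
    (p q : Fin n × Fin n) :
    fourthMoment τ p q = (if p.1 = k then -1 else 1) * (if p.2 = k then -1 else 1) *
      ((if q.1 = k then -1 else 1) * (if q.2 = k then -1 else 1)) * fourthMoment τ p q := by
  set e : Fin n → ℝ := fun i => if i = k then -1 else 1 with he
  have hesq : ∀ i, e i ^ 2 = 1 := fun i => by simp only [he]; split_ifs <;> norm_num
  have hmp : MeasurePreserving (fun x : Fin n → ℝ => fun i => e i * x i)
      (Measure.pi fun _ : Fin n => τ) (Measure.pi fun _ : Fin n => τ) := by
    refine measurePreserving_pi (fun _ => τ) (fun _ => τ) (f := fun i y => e i * y) fun i => ?_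
    simp only [he]
    split_ifs
    · simp only [neg_one_mul]; exact ⟨measurable_neg, hτ⟩
    · simp only [one_mul]; exact MeasurePreserving.id τ
  have hunit : ∀ x i, unitVec (fun i => e i * x i) i = e i * unitVec x i := by
    intro x i
    simp only [unitVec, mul_pow, hesq, one_mul, mul_div_assoc]
  have h1 : fourthMoment τ p q = ∫ x, (e p.1 * unitVec x p.1) * (e p.2 * unitVec x p.2) *
      ((e q.1 * unitVec x q.1) * (e q.2 * unitVec x q.2)) ∂(Measure.pi fun _ : Fin n => τ) := by
    have := integral_map (f := fun x => unitVec x p.1 * unitVec x p.2 *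
      (unitVec x q.1 * unitVec x q.2)) hmp.measurable.aemeasurable
      (by rw [hmp.map_eq]; exact (integrable_fourth p q).aestronglyMeasurable)
    rw [hmp.map_eq] at this
    simp only [hunit] at this
    exact this
  refine h1.trans ?_
  rw [fourthMoment, ← integral_const_mul]
  refine integral_congr_ae (Eventually.of_forall fun x => ?_)
  simp only [he]
  ring

/-- Two off-diagonal pairs with different underlying sets leave some index of `p` occurring exactly
once among the four. Flipping its sign negates the moment. -/
theorem fourthMoment_eq_zero (hτ : τ.map (fun x => -x) = τ) {p q : Fin n × Fin n}
    (hp : p.1 ≠ p.2) (hq : q.1 ≠ q.2) (hpq : q ≠ p) (hpq' : q ≠ p.swap) :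
    fourthMoment τ p q = 0 := by
  obtain ⟨i, j⟩ := p
  obtain ⟨k, l⟩ := q
  simp only [ne_eq, Prod.swap_prod_mk, Prod.mk.injEq, not_and] at hp hq hpq hpq'
  by_cases hi : k ≠ i ∧ l ≠ i
  · have := fourthMoment_eq_of_sign hτ i (i, j) (k, l)
    simp only [if_true, hi.1, hi.2, if_false, Ne.symm hp] at this
    linarith
  · have hj : k ≠ j ∧ l ≠ j := by
      by_contra hj
      grind
    have := fourthMoment_eq_of_sign hτ j (i, j) (k, l)
    simp only [if_true, hj.1, hj.2, if_false, hp] at this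
    linarith

theorem fourthMoment_perm (σ : Equiv.Perm (Fin n)) (p q : Fin n × Fin n) :
    fourthMoment τ (σ p.1, σ p.2) (σ q.1, σ q.2) = fourthMoment τ p q := by
  have hmp : MeasurePreserving (fun x : Fin n → ℝ => x ∘ σ)
      (Measure.pi fun _ : Fin n => τ) (Measure.pi fun _ : Fin n => τ) := by
    have := measurePreserving_arrowCongr' (fun _ : Fin n => τ) (fun _ : Fin n => τ) σ.symm
      (MeasurableEquiv.refl ℝ) fun _ => MeasurePreserving.id τ
    exact this
  have hunit : ∀ x i, unitVec (x ∘ σ) i = unitVec x (σ i) := by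
    intro x i
    simp only [unitVec, Function.comp]
    rw [Equiv.sum_comp σ fun j => x j ^ 2]
  have := integral_map (f := fun x => unitVec x p.1 * unitVec x p.2 *
    (unitVec x q.1 * unitVec x q.2)) hmp.measurable.aemeasurable
    (by rw [hmp.map_eq]; exact (integrable_fourth p q).aestronglyMeasurable)
  rw [hmp.map_eq] at this
  simp only [hunit] at this
  exact this.symm

theorem fourthMoment_pair_eq {p q : Fin n × Fin n} (hp : p.1 ≠ p.2) (hq : q.1 ≠ q.2) :
    fourthMoment τ p p = fourthMoment τ q q := by
  obtain ⟨σ, h1, h2⟩ : ∃ σ : Equiv.Perm (Fin n), σ p.1 = q.1 ∧ σ p.2 = q.2 := by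
    -- The second swap moves the image of `p.2` to `q.2` without disturbing `q.1`, because that
    -- image differs from `q.1`.
    refine ⟨(Equiv.swap p.1 q.1).trans (Equiv.swap (Equiv.swap p.1 q.1 p.2) q.2), ?_, ?_⟩
    · simp only [Equiv.trans_apply, Equiv.swap_apply_left]
      refine Equiv.swap_apply_of_ne_of_ne ?_ hq
      intro h
      have := congrArg (Equiv.swap p.1 q.1) h
      simp only [Equiv.swap_apply_right, Equiv.swap_apply_self] at this
      exact hp (by simpa using this)
    · simp
  have := fourthMoment_perm (τ := τ) σ p p
  rw [h1, h2] at this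
  exact this.symm

/-- The `n (n - 1)` off-diagonal moments are equal and sum to at most `E (∑ yᵢ²)² ≤ 1`; moreover `n
(n - 1) ≥ n² / 2` for `n ≥ 2`. -/
theorem fourthMoment_pair_le (hn : 2 ≤ n) {p : Fin n × Fin n} (hp : p.1 ≠ p.2) :
    fourthMoment τ p p ≤ 2 / (n : ℝ) ^ 2 := by
  have hsum : ∑ q ∈ (Finset.univ : Finset (Fin n)).offDiag, fourthMoment τ q q ≤ 1 := by
    simp only [fourthMoment]
    rw [← integral_finsetSum _ fun q _ => integrable_fourth q q]
    refine (integral_mono (integrable_finsetSum _ fun q _ => integrable_fourth q q)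
      (integrable_const 1) fun x => ?_).trans_eq (by simp)
    calc ∑ q ∈ (Finset.univ : Finset (Fin n)).offDiag,
          unitVec x q.1 * unitVec x q.2 * (unitVec x q.1 * unitVec x q.2)
        ≤ ∑ q : Fin n × Fin n, unitVec x q.1 * unitVec x q.2 * (unitVec x q.1 * unitVec x q.2) :=
          Finset.sum_le_sum_of_subset_of_nonneg (Finset.subset_univ _)
            fun q _ _ => mul_self_nonneg _
      _ = (∑ i, unitVec x i ^ 2) * ∑ i, unitVec x i ^ 2 := by
          rw [Finset.sum_mul_sum, Fintype.sum_prod_type]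
          refine Finset.sum_congr rfl fun i _ => Finset.sum_congr rfl fun j _ => ?_
          ring
      _ ≤ 1 := mul_le_one₀ (sum_sq_unitVec_le_one x)
          (Finset.sum_nonneg fun i _ => sq_nonneg _) (sum_sq_unitVec_le_one x)
  rw [Finset.sum_congr rfl fun q hq => fourthMoment_pair_eq (τ := τ) (Finset.mem_offDiag.1 hq).2.2
    hp, Finset.sum_const, Finset.offDiag_card, Finset.card_univ, Fintype.card_fin, nsmul_eq_mul,
    Nat.cast_sub (Nat.le_mul_self n)] at hsum
  push_cast at hsum
  have hn' : (2 : ℝ) ≤ n := by exact_mod_cast hn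
  have h0 : 0 ≤ fourthMoment τ p p := integral_nonneg fun x => mul_self_nonneg _
  rw [le_div_iff₀ (by positivity)]
  nlinarith

/-- Second moment bound for an off-diagonal quadratic form of the normalized vector. -/
theorem integral_offDiag_sq_le (hτ : τ.map (fun x => -x) = τ) (hn : 2 ≤ n)
    {B : Fin n × Fin n → ℝ} (hB : ∀ i, B (i, i) = 0) :
    ∫ x, (∑ p, B p * (unitVec x p.1 * unitVec x p.2)) ^ 2 ∂(Measure.pi fun _ : Fin n => τ) ≤
      4 / (n : ℝ) ^ 2 * ∑ p, B p ^ 2 := by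
  have hB' : ∀ p : Fin n × Fin n, p.1 = p.2 → B p = 0 := by
    rintro ⟨i, j⟩ h
    simp only at h
    subst h
    exact hB i
  have e1 : ∀ x : Fin n → ℝ, (∑ p, B p * (unitVec x p.1 * unitVec x p.2)) ^ 2 =
      ∑ p, ∑ q, B p * B q * (unitVec x p.1 * unitVec x p.2 * (unitVec x q.1 * unitVec x q.2)) := by
    intro x
    rw [sq, Finset.sum_mul_sum]
    refine Finset.sum_congr rfl fun p _ => Finset.sum_congr rfl fun q _ => ?_
    ring
  simp_rw [e1]
  rw [integral_finsetSum _ fun p _ => integrable_finsetSum _ fun q _ =>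
    (integrable_fourth p q).const_mul _]
  -- Only `q = p` and `q = p.swap` survive. The cross term is split by `B p * B p.swap ≤ (B p ^ 2 +
  -- B p.swap ^ 2) / 2`, and the weights `3/2` and `1/2` add up to `2` after summation over `p`.
  have e2 : ∀ p : Fin n × Fin n, ∫ x, ∑ q, B p * B q *
      (unitVec x p.1 * unitVec x p.2 * (unitVec x q.1 * unitVec x q.2))
        ∂(Measure.pi fun _ : Fin n => τ) ≤
      2 / (n : ℝ) ^ 2 * (3 / 2 * B p ^ 2 + 1 / 2 * B p.swap ^ 2) := by
    intro p
    rw [integral_finsetSum _ fun q _ => (integrable_fourth p q).const_mul _]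
    simp_rw [integral_const_mul]
    by_cases hp : p.1 = p.2
    · rw [Finset.sum_eq_zero fun q _ => by rw [hB' p hp]; ring]
      positivity
    · have hps : p ≠ p.swap := by
        intro h
        exact hp (congrArg Prod.fst h)
      have hswap : fourthMoment τ p p.swap = fourthMoment τ p p := by
        unfold fourthMoment
        refine integral_congr_ae (Eventually.of_forall fun x => ?_)
        simp only [Prod.fst_swap, Prod.snd_swap]
        ring
      have hs : ∑ q, B p * B q * fourthMoment τ p q =
          B p * B p * fourthMoment τ p p + B p * B p.swap * fourthMoment τ p p := by
        rw [← Finset.sum_subset (Finset.subset_univ {p, p.swap}), Finset.sum_pair hps, hswap]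
        intro q _ hq
        simp only [Finset.mem_insert, Finset.mem_singleton, not_or] at hq
        by_cases hq' : q.1 = q.2
        · rw [hB' q hq']; ring
        · rw [fourthMoment_eq_zero hτ hp hq' hq.1 hq.2, mul_zero]
      change ∑ q, B p * B q * fourthMoment τ p q ≤ _
      rw [hs]
      have h0 : 0 ≤ fourthMoment τ p p := integral_nonneg fun x => mul_self_nonneg _
      calc B p * B p * fourthMoment τ p p + B p * B p.swap * fourthMoment τ p p
          ≤ fourthMoment τ p p * (3 / 2 * B p ^ 2 + 1 / 2 * B p.swap ^ 2) := by
            have : 0 ≤ fourthMoment τ p p * (B p - B p.swap) ^ 2 := by positivity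
            nlinarith
        _ ≤ _ := by
            gcongr
            exact fourthMoment_pair_le hn hp
  refine (Finset.sum_le_sum fun p _ => e2 p).trans_eq ?_
  rw [← Finset.mul_sum, Finset.sum_add_distrib, ← Finset.mul_sum, ← Finset.mul_sum,
    show ∑ p : Fin n × Fin n, B p.swap ^ 2 = ∑ p, B p ^ 2 from
      (Equiv.prodComm (Fin n) (Fin n)).sum_comp fun p => B p ^ 2]
  ring

end

/-! ### Splitting the quadratic form into diagonal and off-diagonal parts. -/

theorem frobNorm_sq {n : ℕ} (B : Matrix (Fin n) (Fin n) ℂ) :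
    frobNorm B ^ 2 = ∑ p : Fin n × Fin n, ‖B p.1 p.2‖ ^ 2 := by
  have h : frobNorm B = (∑ i, ∑ j, ‖B i j‖ ^ (2 : ℝ)) ^ (1 / 2 : ℝ) :=
    Matrix.frobenius_norm_def B
  have h0 : 0 ≤ ∑ i, ∑ j, ‖B i j‖ ^ 2 :=
    Finset.sum_nonneg fun i _ => Finset.sum_nonneg fun j _ => sq_nonneg _
  rw [h, Fintype.sum_prod_type]
  simp only [Real.rpow_two]
  rw [← Real.sqrt_eq_rpow, Real.sq_sqrt h0]

/-- The diagonal part of the quadratic form. -/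
def diagForm {n : ℕ} (B : Fin n → Fin n → ℂ) (y : Fin n → ℝ) : ℝ := ∑ i, (B i i).re * y i ^ 2

/-- The off-diagonal part of the quadratic form. -/
def offDiagForm {n : ℕ} (B : Fin n → Fin n → ℂ) (y : Fin n → ℝ) : ℝ :=
  ∑ p : Fin n × Fin n, (if p.1 = p.2 then 0 else (B p.1 p.2).re) * (y p.1 * y p.2)

theorem measurable_diagForm (n : ℕ) :
    Measurable fun q : (Fin n → Fin n → ℂ) × (Fin n → ℝ) => diagForm q.1 q.2 := by
  unfold diagForm
  fun_prop

theorem measurable_offDiagForm (n : ℕ) :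
    Measurable fun q : (Fin n → Fin n → ℂ) × (Fin n → ℝ) => offDiagForm q.1 q.2 := by
  unfold offDiagForm
  refine Finset.measurable_fun_sum _ fun p _ => ?_
  split_ifs <;> fun_prop

theorem quadForm_eq_add {n : ℕ} (y : Fin n → ℝ) (A : Matrix (Fin n) (Fin n) ℂ) :
    quadForm y A = diagForm (fun i j => A i j) y + offDiagForm (fun i j => A i j) y := by
  have h1 : quadForm y A = ∑ i, ∑ j, (A i j).re * (y i * y j) := by
    simp only [quadForm, dotProduct, Matrix.mulVec, Finset.mul_sum, Complex.re_sum]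
    refine Finset.sum_congr rfl fun i _ => Finset.sum_congr rfl fun j _ => ?_
    simp
    ring
  rw [h1, diagForm, offDiagForm, Fintype.sum_prod_type, ← Finset.sum_add_distrib]
  refine Finset.sum_congr rfl fun i _ => ?_
  have h2 : (A i i).re * y i ^ 2 = ∑ j, if i = j then (A i j).re * (y i * y j) else 0 := by
    simp [sq]
  rw [h2, ← Finset.sum_add_distrib]
  refine Finset.sum_congr rfl fun j _ => ?_
  simp only
  split_ifs <;> simp

theorem sum_sq_le_frobNorm_sq {n : ℕ} (A : Matrix (Fin n) (Fin n) ℂ) :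
    ∑ p : Fin n × Fin n, (if p.1 = p.2 then 0 else (A p.1 p.2).re) ^ 2 ≤
      frobNorm (offDiagPart A) ^ 2 := by
  rw [frobNorm_sq]
  refine Finset.sum_le_sum fun p _ => ?_
  split_ifs with h
  · simp
  · have : offDiagPart A p.1 p.2 = A p.1 p.2 := by
      simp [offDiagPart, Matrix.diagonal_apply_ne _ h]
    rw [this, ← sq_abs]
    gcongr
    exact Complex.abs_re_le_norm _

theorem integral_empiricalDiag {n : ℕ} (A : Matrix (Fin n) (Fin n) ℂ) (f : ℝ →ᵇ ℝ) :
    ∫ x, f x ∂(empiricalDiag A : Measure ℝ) = (n : ℝ)⁻¹ * ∑ i, f (A i i).re := by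
  have h : (empiricalDiag A : Measure ℝ) =
      ((n : ℝ≥0)⁻¹) • ∑ i : Fin n, Measure.dirac (A i i).re := by
    rw [empiricalDiag, FiniteMeasure.toMeasure_smul, FiniteMeasure.toMeasure_sum]
    rfl
  rw [h, integral_smul_nnreal_measure, integral_finsetSum_measure fun i _ => f.integrable _]
  simp only [integral_dirac]
  rw [NNReal.smul_def, smul_eq_mul]
  simp

/-! ### Random matrices: conditioning on the matrix by independence. -/

section

variable {Ω : Type*} [MeasurableSpace Ω] {P : Measure Ω} [IsProbabilityMeasure P] {α : ℝ}
  {X : ℕ → Ω → ℝ}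

theorem hasScale_of_regularlyVaryingTail {ξ : Ω → ℝ} (hξ : AEMeasurable ξ P) (hα₀ : 0 < α)
    (hα₂ : α < 2) (hreg : RegularlyVaryingTail P ξ α) : HasScale (P.map ξ) (α / 2) := by
  have : IsProbabilityMeasure (P.map ξ) := Measure.isProbabilityMeasure_map hξ
  obtain ⟨L, hLpos, hL, htail⟩ := hreg
  obtain ⟨h1, h2⟩ := sq_tail_regular (μ := P.map ξ) hLpos hL fun x hx => by
    rw [map_measureReal_apply_of_aemeasurable hξ
      (measurableSet_lt measurable_const (by fun_prop))]
    exact htail x hx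
  exact exists_scale (half_pos hα₀) (by linarith) h1 h2

theorem map_prefix_eq_pi (hindep : iIndepFun X P) (hident : ∀ i, IdentDistrib (X i) (X 0) P P)
    (n : ℕ) : P.map (fun ω (i : Fin n) => X i ω) = Measure.pi fun _ : Fin n => P.map (X 0) := by
  have h1 : iIndepFun (fun i : Fin n => X i) P := hindep.precomp Fin.val_injective
  rw [(iIndepFun_iff_map_fun_eq_pi_map fun i : Fin n => (hident i).aemeasurable_fst).1 h1]
  congr 1
  ext1 i
  exact (hident i).map_eq

/-- The joint law of the matrix and the normalized vector, as a product. -/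
theorem map_prod_eq (hindep : iIndepFun X P) (hident : ∀ i, IdentDistrib (X i) (X 0) P P) {n : ℕ}
    {A : Ω → Matrix (Fin n) (Fin n) ℂ} (hmeas : ∀ i j, Measurable fun ω => A ω i j)
    (hAy : IndepFun (fun ω i j => A ω i j) (fun ω => selfNormalized n fun k => X k ω) P) :
    P.map (fun ω => ((fun i j => A ω i j : Fin n → Fin n → ℂ),
        selfNormalized n fun k => X k ω)) =
      (P.prod (Measure.pi fun _ : Fin n => P.map (X 0))).map
        fun q => ((fun i j => A q.1 i j : Fin n → Fin n → ℂ), unitVec q.2) := by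
  have : IsProbabilityMeasure (P.map (X 0)) :=
    Measure.isProbabilityMeasure_map (hident 0).aemeasurable_fst
  have hX : AEMeasurable (fun ω (i : Fin n) => X i ω) P :=
    aemeasurable_pi_lambda _ fun i => (hident i).aemeasurable_fst
  have hA : Measurable fun ω => (fun i j => A ω i j : Fin n → Fin n → ℂ) :=
    measurable_pi_lambda _ fun i => measurable_pi_lambda _ fun j => hmeas i j
  have hy : AEMeasurable (fun ω => selfNormalized n fun k => X k ω) P :=
    (measurable_unitVec n).comp_aemeasurable hX
  rw [(indepFun_iff_map_prod_eq_prod_map_map hA.aemeasurable hy).1 hAy]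
  have e : P.map (fun ω => selfNormalized n fun k => X k ω) =
      (Measure.pi fun _ : Fin n => P.map (X 0)).map unitVec := by
    rw [← map_prefix_eq_pi hindep hident n,
      AEMeasurable.map_map_of_aemeasurable (measurable_unitVec n).aemeasurable hX]
    rfl
  rw [e, Measure.map_prod_map _ _ hA (measurable_unitVec n)]
  rfl

/-- Convergence of the law of the diagonal part. -/
theorem tendsto_integral_diagForm (hindep : iIndepFun X P)
    (hident : ∀ i, IdentDistrib (X i) (X 0) P P) (hα₀ : 0 < α)
    (hscale : HasScale (P.map (X 0)) (α / 2)) {A : (n : ℕ) → Ω → Matrix (Fin n) (Fin n) ℂ}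
    (hmeas : ∀ n i j, Measurable (fun ω => A n ω i j))
    (hAy : ∀ n, IndepFun (fun ω i j => A n ω i j) (fun ω => selfNormalized n (fun k => X k ω)) P)
    {ν μ : ProbabilityMeasure ℝ} {m M : ℝ}
    (hK : closure (convexHull ℝ (ν : Measure ℝ).support) = Set.Icc m M)
    (hμ : IsQuadFormLaw ν α μ)
    (hgood : ∀ᵐ ω ∂P, (∃ C : ℝ, 0 ≤ C ∧
        ∀ᶠ n in atTop, ∀ i, (A n ω i i).re ∈ Set.Icc (-C) C) ∧
      ∀ f : ℝ →ᵇ ℝ, Tendsto (fun n : ℕ => (n : ℝ)⁻¹ * ∑ i, f (A n ω i i).re) atTop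
        (𝓝 (∫ x, f x ∂(ν : Measure ℝ)))) (f : ℝ →ᵇ ℝ) :
    Tendsto (fun n => ∫ ω, f (diagForm (fun i j => A n ω i j)
      (selfNormalized n fun k => X k ω)) ∂P) atTop (𝓝 (∫ x, f x ∂(μ : Measure ℝ))) := by
  have hτp : IsProbabilityMeasure (P.map (X 0)) :=
    Measure.isProbabilityMeasure_map (hident 0).aemeasurable_fst
  have hA : ∀ n, Measurable fun ω => (fun i j => A n ω i j : Fin n → Fin n → ℂ) := fun n =>
    measurable_pi_lambda _ fun i => measurable_pi_lambda _ fun j => hmeas n i j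
  have hpair : ∀ n, Measurable fun q : Ω × (Fin n → ℝ) =>
      ((fun i j => A n q.1 i j : Fin n → Fin n → ℂ), unitVec q.2) := fun n =>
    ((hA n).comp measurable_fst).prodMk ((measurable_unitVec n).comp measurable_snd)
  have hfm : ∀ n, Measurable fun q : (Fin n → Fin n → ℂ) × (Fin n → ℝ) =>
      f (diagForm q.1 q.2) := fun n => f.continuous.measurable.comp (measurable_diagForm n)
  have heq : ∀ n, ∫ ω, f (diagForm (fun i j => A n ω i j)
      (selfNormalized n fun k => X k ω)) ∂P = ∫ ω, ∫ x, f (diagForm (fun i j => A n ω i j)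
        (unitVec x)) ∂(Measure.pi fun _ : Fin n => P.map (X 0)) ∂P := by
    intro n
    have hX : AEMeasurable (fun ω (i : Fin n) => X i ω) P :=
      aemeasurable_pi_lambda _ fun i => (hident i).aemeasurable_fst
    have h1 : AEMeasurable (fun ω => ((fun i j => A n ω i j : Fin n → Fin n → ℂ),
        selfNormalized n fun k => X k ω)) P :=
      (hA n).aemeasurable.prodMk ((measurable_unitVec n).comp_aemeasurable hX)
    rw [← integral_map (f := fun q : (Fin n → Fin n → ℂ) × (Fin n → ℝ) => f (diagForm q.1 q.2))
      h1 (hfm n).aestronglyMeasurable, map_prod_eq hindep hident (hmeas n) (hAy n),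
      integral_map (hpair n).aemeasurable (hfm n).aestronglyMeasurable, integral_prod]
    exact Integrable.of_bound ((hfm n).comp (hpair n)).aestronglyMeasurable ‖f‖
      (Eventually.of_forall fun q => f.norm_coe_le_norm _)
  simp_rw [heq]
  have hlim : ∫ x, f x ∂(μ : Measure ℝ) = ∫ _ω, (∫ x, f x ∂(μ : Measure ℝ)) ∂P := by simp
  rw [hlim]
  -- The inner integral converges for almost every frozen `ω`, and `‖f‖` dominates.
  refine tendsto_integral_of_dominated_convergence (fun _ => ‖f‖) (fun n => ?_)
    (integrable_const _) (fun n => Eventually.of_forall fun ω => ?_) ?_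
  · exact ((hfm n).comp (hpair n)).stronglyMeasurable.integral_prod_right'.aestronglyMeasurable
  · refine (norm_integral_le_of_norm_le_const (Eventually.of_forall fun x =>
      f.norm_coe_le_norm _)).trans (by simp)
  · filter_upwards [hgood] with ω hω
    obtain ⟨⟨C, hC0, hC⟩, hν⟩ := hω
    -- The bound `C` on the diagonal depends on `ω`, but the limit does not: `μ` is identified
    -- through its transform near `+∞`.
    have hsub : Set.Icc m M ⊆ Set.Icc (-max |m| |M|) (max |m| |M|) := by
      refine Set.Icc_subset_Icc ?_ ((le_abs_self M).trans (le_max_right _ _))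
      have := neg_abs_le m
      have := le_max_left |m| |M|
      linarith
    exact hscale.tendsto_diagForm (half_pos hα₀) (by linarith : -C ≤ C) hC hν
      ((hμ.ae_mem hK).mono fun x hx => hsub hx)
      (fun z hz => hμ.real_stieltjes hK
        (((le_abs_self M).trans (le_max_right _ _)).trans_lt hz)) f

/-- Mean square bound for the off-diagonal part. -/
theorem lintegral_offDiagForm_sq_le (hindep : iIndepFun X P)
    (hident : ∀ i, IdentDistrib (X i) (X 0) P P)
    (hsymm : IdentDistrib (X 0) (fun ω => -X 0 ω) P P) {n : ℕ} (hn : 2 ≤ n)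
    {A : Ω → Matrix (Fin n) (Fin n) ℂ} (hmeas : ∀ i j, Measurable fun ω => A ω i j)
    (hAy : IndepFun (fun ω i j => A ω i j) (fun ω => selfNormalized n fun k => X k ω) P) :
    ∫⁻ ω, ENNReal.ofReal (offDiagForm (fun i j => A ω i j)
      (selfNormalized n fun k => X k ω) ^ 2) ∂P ≤
      4 * ((∫⁻ ω, ENNReal.ofReal (frobNorm (offDiagPart (A ω)) ^ 2) ∂P) / (n : ℝ≥0∞) ^ 2) := by
  have hX0 : AEMeasurable (X 0) P := (hident 0).aemeasurable_fst
  have hτp : IsProbabilityMeasure (P.map (X 0)) := Measure.isProbabilityMeasure_map hX0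
  have hτ : (P.map (X 0)).map (fun x => -x) = P.map (X 0) := by
    rw [AEMeasurable.map_map_of_aemeasurable measurable_neg.aemeasurable hX0]
    exact hsymm.map_eq.symm
  have hA : Measurable fun ω => (fun i j => A ω i j : Fin n → Fin n → ℂ) :=
    measurable_pi_lambda _ fun i => measurable_pi_lambda _ fun j => hmeas i j
  have hpair : Measurable fun q : Ω × (Fin n → ℝ) =>
      ((fun i j => A q.1 i j : Fin n → Fin n → ℂ), unitVec q.2) :=
    (hA.comp measurable_fst).prodMk ((measurable_unitVec n).comp measurable_snd)
  have hG : Measurable fun q : (Fin n → Fin n → ℂ) × (Fin n → ℝ) =>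
      ENNReal.ofReal (offDiagForm q.1 q.2 ^ 2) :=
    ((measurable_offDiagForm n).pow_const 2).ennreal_ofReal
  have hX : AEMeasurable (fun ω (i : Fin n) => X i ω) P :=
    aemeasurable_pi_lambda _ fun i => (hident i).aemeasurable_fst
  have h1 : AEMeasurable (fun ω => ((fun i j => A ω i j : Fin n → Fin n → ℂ),
      selfNormalized n fun k => X k ω)) P :=
    hA.aemeasurable.prodMk ((measurable_unitVec n).comp_aemeasurable hX)
  rw [← lintegral_map' (f := fun q : (Fin n → Fin n → ℂ) × (Fin n → ℝ) =>
      ENNReal.ofReal (offDiagForm q.1 q.2 ^ 2)) hG.aemeasurable h1,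
    map_prod_eq hindep hident hmeas hAy, lintegral_map hG hpair]
  refine (lintegral_prod _ (hG.comp hpair).aemeasurable).trans_le ?_
  have hn0 : (0 : ℝ) < n := by positivity
  -- With the matrix frozen, the deterministic second moment bound applies; integrating over `ω`
  -- then brings in the expected Frobenius norm.
  have hinner : ∀ ω, ∫⁻ x, ENNReal.ofReal (offDiagForm (fun i j => A ω i j) (unitVec x) ^ 2)
      ∂(Measure.pi fun _ : Fin n => P.map (X 0)) ≤
      ENNReal.ofReal (4 / (n : ℝ) ^ 2) *
        ENNReal.ofReal (frobNorm (offDiagPart (A ω)) ^ 2) := by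
    intro ω
    have hint : Integrable (fun x => offDiagForm (fun i j => A ω i j) (unitVec x) ^ 2)
        (Measure.pi fun _ : Fin n => P.map (X 0)) := by
      have e : ∀ x : Fin n → ℝ, offDiagForm (fun i j => A ω i j) (unitVec x) ^ 2 =
          ∑ p : Fin n × Fin n, ∑ q : Fin n × Fin n,
            ((if p.1 = p.2 then 0 else (A ω p.1 p.2).re) *
              (if q.1 = q.2 then 0 else (A ω q.1 q.2).re)) *
            (unitVec x p.1 * unitVec x p.2 * (unitVec x q.1 * unitVec x q.2)) := by
        intro x
        rw [sq, offDiagForm, Finset.sum_mul_sum]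
        refine Finset.sum_congr rfl fun p _ => Finset.sum_congr rfl fun q _ => ?_
        ring
      simp_rw [e]
      exact integrable_finsetSum _ fun p _ => integrable_finsetSum _ fun q _ =>
        (integrable_fourth p q).const_mul _
    rw [← ofReal_integral_eq_lintegral_ofReal hint (Eventually.of_forall fun x => sq_nonneg _),
      ← ENNReal.ofReal_mul (by positivity)]
    refine ENNReal.ofReal_le_ofReal ?_
    refine (integral_offDiag_sq_le hτ hn
      (B := fun p => if p.1 = p.2 then 0 else (A ω p.1 p.2).re) (fun i => by simp)).trans ?_
    gcongr
    exact sum_sq_le_frobNorm_sq (A ω)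
  refine (lintegral_mono hinner).trans_eq ?_
  rw [lintegral_const_mul' _ _ ENNReal.ofReal_ne_top, ENNReal.ofReal_div_of_pos (by positivity),
    ENNReal.ofReal_pow hn0.le, ENNReal.ofReal_natCast, ENNReal.div_eq_inv_mul,
    ENNReal.div_eq_inv_mul, ENNReal.ofReal_ofNat]
  ring

end

end HeavyQuadForm

end

/-! ### Proof of the main theorem. -/

open HeavyQuadForm

theorem mainTheorem6 {Ω : Type*} [MeasurableSpace Ω] (P : Measure Ω) [IsProbabilityMeasure P]
    (α : ℝ) (hα₀ : 0 < α) (hα₂ : α < 2)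
    -- the i.i.d. copies of a symmetric, regularly varying random variable
    (X : ℕ → Ω → ℝ)
    (hindep : iIndepFun X P)
    (hident : ∀ i, IdentDistrib (X i) (X 0) P P)
    (hsymm : IdentDistrib (X 0) (fun ω => -X 0 ω) P P)
    (hreg : HeavyQuadForm.RegularlyVaryingTail P (X 0) α)
    -- the random Hermitian matrices, independent of the self-normalized vectors
    (A : (n : ℕ) → Ω → Matrix (Fin n) (Fin n) ℂ)
    (hmeas : ∀ n i j, Measurable (fun ω => A n ω i j))
    (hherm : ∀ n ω, (A n ω).IsHermitian)
    (hAy : ∀ n, IndepFun (fun ω i j => A n ω i j)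
      (fun ω => HeavyQuadForm.selfNormalized n (fun k => X k ω)) P)
    -- the diagonal entries are eventually bounded, almost surely
    (hbdd : ∀ᵐ ω ∂P, limsup (fun n => ⨆ i : Fin n, ‖A n ω i i‖ₑ) atTop < ∞)
    -- the empirical measures of the diagonals converge weakly to `ν`, almost surely
    (ν : ProbabilityMeasure ℝ)
    (hweak : ∀ᵐ ω ∂P, Tendsto (fun n => HeavyQuadForm.empiricalDiag (A n ω)) atTop
      (𝓝 ν.toFiniteMeasure))
    -- the off-diagonal parts are small in mean square
    (hoff : Tendsto (fun n : ℕ =>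
      (∫⁻ ω, ENNReal.ofReal (HeavyQuadForm.frobNorm (HeavyQuadForm.offDiagPart (A n ω)) ^ 2) ∂P) /
        (n : ℝ≥0∞) ^ 2) atTop (𝓝 0)) :
    ∃ μ : ProbabilityMeasure ℝ,
      HeavyQuadForm.IsQuadFormLaw ν α μ ∧
      (∀ μ' : ProbabilityMeasure ℝ, HeavyQuadForm.IsQuadFormLaw ν α μ' → μ' = μ) ∧
      TendstoInDistribution
        (fun (n : ℕ) ω =>
          HeavyQuadForm.quadForm (HeavyQuadForm.selfNormalized n (fun k => X k ω)) (A n ω))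
        atTop (id : ℝ → ℝ) (fun _ => P) (μ : Measure ℝ) := by
  set τ := P.map (X 0) with hτdef
  have hX0 : AEMeasurable (X 0) P := (hident 0).aemeasurable_fst
  have hτp : IsProbabilityMeasure τ := Measure.isProbabilityMeasure_map hX0
  have hscale : HasScale τ (α / 2) := hasScale_of_regularlyVaryingTail hX0 hα₀ hα₂ hreg
  have hgood : ∀ᵐ ω ∂P, (∃ C : ℝ, 0 ≤ C ∧
        ∀ᶠ n in atTop, ∀ i, (A n ω i i).re ∈ Set.Icc (-C) C) ∧
      ∀ f : ℝ →ᵇ ℝ, Tendsto (fun n : ℕ => (n : ℝ)⁻¹ * ∑ i, f (A n ω i i).re) atTop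
        (𝓝 (∫ x, f x ∂(ν : Measure ℝ))) := by
    filter_upwards [hbdd, hweak] with ω h1 h2
    constructor
    · obtain ⟨C, hC1, hC2⟩ := ENNReal.lt_iff_exists_nnreal_btwn.1 h1
      refine ⟨C, C.2, ?_⟩
      filter_upwards [eventually_lt_of_limsup_lt hC1] with n hn i
      have h3 : ‖A n ω i i‖ₑ < C := (le_iSup (fun i => ‖A n ω i i‖ₑ) i).trans_lt hn
      have h4 : ‖A n ω i i‖ ≤ C := by
        rw [enorm_eq_nnnorm, ENNReal.coe_lt_coe] at h3
        exact_mod_cast h3.le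
      exact abs_le.1 ((Complex.abs_re_le_norm _).trans h4)
    · intro f
      have := FiniteMeasure.tendsto_iff_forall_integral_tendsto.1 h2 f
      simp only [integral_empiricalDiag] at this
      exact this
  obtain ⟨m, M, hmM, hK⟩ : ∃ m M, m ≤ M ∧
      closure (convexHull ℝ (ν : Measure ℝ).support) = Set.Icc m M := by
    -- Because `ν` is deterministic, a single good `ω` shows that it has bounded support.
    obtain ⟨ω, ⟨C, hC0, hC⟩, hω⟩ := hgood.exists
    refine closure_convexHull_eq_Icc (Measure.nonempty_support (NeZero.ne _)) (l := -C) (r := C) ?_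
    exact Measure.support_subset_of_isClosed isClosed_Icc
      (ae_mem_Icc_of_empirical (by linarith) hC hω)
  obtain ⟨μ, hμ⟩ : ∃ μ : ProbabilityMeasure ℝ, IsQuadFormLaw ν α μ := by
    obtain ⟨ω, -, hω⟩ := hgood.exists
    exact exists_isQuadFormLaw hscale hα₀ hα₂ hω hmM hK
  refine ⟨μ, hμ, fun μ' hμ' => hμ.unique hμ' hK, ?_⟩
  have hX : ∀ n, AEMeasurable (fun ω (i : Fin n) => X i ω) P := fun n =>
    aemeasurable_pi_lambda _ fun i => (hident i).aemeasurable_fst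
  have hpair : ∀ n, AEMeasurable (fun ω => ((fun i j => A n ω i j : Fin n → Fin n → ℂ),
      selfNormalized n fun k => X k ω)) P := fun n =>
    (measurable_pi_lambda _ fun i => measurable_pi_lambda _ fun j =>
      hmeas n i j).aemeasurable.prodMk ((measurable_unitVec n).comp_aemeasurable (hX n))
  have hDm : ∀ n, AEMeasurable (fun ω => diagForm (fun i j => A n ω i j)
      (selfNormalized n fun k => X k ω)) P := fun n =>
    (measurable_diagForm n).comp_aemeasurable (hpair n)
  have hRm : ∀ n, AEMeasurable (fun ω => offDiagForm (fun i j => A n ω i j)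
      (selfNormalized n fun k => X k ω)) P := fun n =>
    (measurable_offDiagForm n).comp_aemeasurable (hpair n)
  -- Slutsky's theorem: the diagonal form converges in distribution and its difference from the full
  -- form tends to `0` in probability.
  refine tendstoInDistribution_of_tendstoInMeasure_sub
    (X := fun n ω => diagForm (fun i j => A n ω i j) (selfNormalized n fun k => X k ω))
    _ id ⟨hDm, aemeasurable_id, ?_⟩ ?_ fun n => ?_
  · refine ProbabilityMeasure.tendsto_iff_forall_integral_tendsto.2 fun f => ?_
    change Tendsto (fun n => ∫ x, f x ∂(P.map fun ω => diagForm (fun i j => A n ω i j)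
      (selfNormalized n fun k => X k ω))) atTop (𝓝 (∫ x, f x ∂((μ : Measure ℝ).map id)))
    rw [Measure.map_id]
    refine (tendsto_integral_diagForm hindep hident hα₀ hscale hmeas hAy hK hμ hgood f).congr
      fun n => ?_
    exact (integral_map (hDm n) f.continuous.aestronglyMeasurable).symm
  · rw [tendstoInMeasure_iff_norm]
    intro ε hε
    have hε' : ENNReal.ofReal (ε ^ 2) ≠ 0 := by simp [hε.ne']
    have hbound : Tendsto (fun n : ℕ => 4 * ((∫⁻ ω, ENNReal.ofReal
        (frobNorm (offDiagPart (A n ω)) ^ 2) ∂P) / (n : ℝ≥0∞) ^ 2) / ENNReal.ofReal (ε ^ 2))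
        atTop (𝓝 0) := by
      have := ENNReal.Tendsto.div_const (ENNReal.Tendsto.const_mul hoff (a := 4) (Or.inr (by simp)))
        (b := ENNReal.ofReal (ε ^ 2)) (Or.inr hε')
      simpa using this
    refine tendsto_of_tendsto_of_tendsto_of_le_of_le' tendsto_const_nhds hbound
      (Eventually.of_forall fun n => zero_le) ?_
    filter_upwards [eventually_ge_atTop 2] with n hn
    -- Chebyshev's inequality, that is, Markov's inequality for the squared off-diagonal form at
    -- level `ε ^ 2`.
    refine le_trans (le_trans (measure_mono ?_) (meas_ge_le_lintegral_div
      ((hRm n).pow_const 2).ennreal_ofReal hε' ENNReal.ofReal_ne_top))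
      (ENNReal.div_le_div_right
        (lintegral_offDiagForm_sq_le hindep hident hsymm hn (hmeas n) (hAy n)) _)
    intro ω hω
    simp only [Set.mem_ofPred_eq, Pi.sub_apply, Pi.zero_apply, sub_zero, quadForm_eq_add,
      add_sub_cancel_left] at hω ⊢
    refine ENNReal.ofReal_le_ofReal ?_
    rw [← sq_abs (offDiagForm _ _)]
    gcongr
    exact hω
  · simp_rw [quadForm_eq_add]
    exact (hDm n).add (hRm n)
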